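/- **Setting.** Let $n$ voters be numbered $1,\dots,n$ by increasing weight, and let $N=\{1,\dots,n\}$. A *simple game* is a collection $W_v$ of ("winning") subsets of $N$ that is closed under supersets, contains $N$ and does not contain $\emptyset$. It is *weighted* if there are weights $w_n\ge\dots\ge w_1\ge 0$ and a quota $0<q\le\sum_i w_i$ such that $A\in W_v$ if and only if $w_A:=\sum_{i\in A}w_i\ge q$. Coalitions are partially ordered by: $A\le B$ if $|A|\le|B|$ and, for all $i\le|A|$, the $i$-th largest member of $A$ is at most the $i$-th largest member of $B$. A *shift-minimal winning* (*shift-maximal losing*) coalition is a minimal winning (maximal losing) coalition in this order, and $\langle A\rangle$ is the game whose winning coalitions are all $C\ge A$. The poset $\mathcal W_n$ consists of the weighted games on $n$ voters with the partial order generated by: $u$ covers $v$ if $W_v=W_u\cup\{A\}$ for a coalition $A\notin W_u$. Voters $i,j$ lie in the same symmetry class of $v$ if for all $S\subseteq N\setminus\{i,j\}$, $S\cup\{i\}\in W_v\Leftrightarrow S\cup\{j\}\in W_v$. A class is *nontrivial* if its voters are not dummies, a dummy being a voter that belongs to no inclusion-minimal winning coalition. Let $\Delta_n=\{w\in\mathbb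 R^n: w_n\ge\dots\ge w_1\ge0,\ \sum_i w_i=1\}$, the simplex with vertices $p_j=(\tfrac1j,\dots,\tfrac1j,0,\dots,0)$, where the $j$ strongest voters have weight $\tfrac1j$. Let $P_v\subset(0,1]\times\Delta_n$ be the set of all $(q,w)$ that realize the weighted game $v$, and let $h_A$ be the hyperplane $q=w_A$. A *facet* of the convex, not necessarily closed, polytope $P_v$ is a nonempty exposed face of its closure of dimension $\dim P_v-1$. A facet is a *top facet* if it lies in $h_A$ for some winning $A$ and its relative interior is contained in $P_v$; a *bottom facet* if it lies in $h_B$ for some losing $B$ and it is disjoint from $P_v$; a *vertical facet* if it lies above a codimension-one subsimplex of $\Delta_n$ (the convex hull of all but one of the $p_j$) and its relative interior is contained in $P_v$. **Theorem.** Let $v$ be a weighted game with $n$ voters and $k$ nontrivial symmetry classes, and let $d$ be the degree of $v$ in the Hasse diagram of $\mathcal W_n$. Every facet of $P_v$ is a top, bottom or vertical facet, and $P_v$ has exactly $n-k+d+\varepsilon$ facets, where $\varepsilon$ is the number of the two equalities $v=\langle N\rangle$, $v=\langle 1\rangle$ that hold (so $n-k+d$ facets if $v\ne\langle N\rangle,\langle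 1\rangle$). 1. If $v\neq\langle N\rangle$, there is a bijection between the weighted games $u$ that cover $v$ in $\mathcal W_n$ and the top facets of $P_v$, under which the facet of $u$ lies in $h_A$, where $A$ is the one coalition with $W_v\setminus W_u=\{A\}$ (and $W_u\subseteq W_v$); moreover $A$ is a shift-minimal winning coalition of $v$. If $v=\langle N\rangle$, there is exactly one top facet, $\{1\}\times\Delta_n$. 2. If $v\neq\langle 1\rangle$, there is a bijection between the weighted games $g$ that are covered by $v$ in $\mathcal W_n$ and the bottom facets of $P_v$, under which the facet of $g$ lies in $h_B$, where $B$ is the one coalition with $W_g\setminus W_v=\{B\}$ (and $W_v\subseteq W_g$); moreover $B$ is a shift-maximal losing coalition of $v$. If $v=\langle 1\rangle$, there is exactly one bottom facet, $\{0\}\times\Delta_n$. 3. $P_v$ has exactly $n-k$ vertical facets. Each of them lies above $\{w\in\Delta_n: w_{i+1}=w_i\}$ for some $1\le i\le n-1$, or above $\{w\in\Delta_n: w_1=0\}$. -/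

import Mathlib

open Set

namespace WeightedVoting

/-! Voters are the elements of `Fin n`: the index `i` is the voter with number `i + 1`, so that index
`0` is the weakest voter `1` and index `n - 1` is the strongest voter `n`.  Coalitions are finsets of
voters. -/

/-- A simple game on `n` voters, given by its collection of winning coalitions. -/
@[ext]
structure SimpleGame (n : ℕ) where
  wins : Set (Finset (Fin n))
  univ_mem : Finset.univ ∈ wins
  empty_notMem : ∅ ∉ wins
  mono : ∀ S R : Finset (Fin n), S ∈ wins → S ⊆ R → R ∈ wins

/-- The weight `w_A` of a coalition. -/
def coalitionWeight {n : ℕ} (w : Fin n → ℝ) (A : Finset (Fin n)) : ℝ := ∑ i ∈ A, w i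

/-- The ordering of coalitions in the poset `M(n)`: `A ≤ B` if `B` has at least as many members
as `A`, and for each `i ≤ |A|` the `i`-th largest member of `A` is at most the `i`-th largest member
of `B`.  (`S.orderEmbOfFin rfl` lists the members of `S` increasingly, so it is evaluated at
reversed positions.) -/
def ShiftLE {n : ℕ} (A B : Finset (Fin n)) : Prop :=
  ∃ h : A.card ≤ B.card, ∀ i : Fin A.card,
    A.orderEmbOfFin rfl i.rev ≤ B.orderEmbOfFin rfl (Fin.castLE h i).rev

/-- The collection of coalitions generated by a single coalition: the filter of `M(n)` above it. -/
def generatedBy {n : ℕ} (A : Finset (Fin n)) : Set (Finset (Fin n)) := {C | ShiftLE A C}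

namespace SimpleGame

variable {n : ℕ}

/-- `v` is weighted: some nonnegative weights and some quota `q ∈ (0, ∑ w]` realize it.  By the
standing convention, voters are numbered by increasing weight. -/
def IsWeighted (v : SimpleGame n) : Prop :=
  ∃ (q : ℝ) (w : Fin n → ℝ), (∀ i, 0 ≤ w i) ∧ Monotone w ∧ 0 < q ∧ q ≤ ∑ i, w i ∧
    ∀ A : Finset (Fin n), A ∈ v.wins ↔ q ≤ coalitionWeight w A

/-- A winning coalition with no winning proper subset. -/
def IsMinimalWinning (v : SimpleGame n) (A : Finset (Fin n)) : Prop :=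
  A ∈ v.wins ∧ ∀ C : Finset (Fin n), C ⊂ A → C ∉ v.wins

/-- A dummy is a voter that appears in no minimal winning coalition. -/
def IsDummy (v : SimpleGame n) (i : Fin n) : Prop :=
  ∀ A : Finset (Fin n), v.IsMinimalWinning A → i ∉ A

/-- Voters `i` and `j` are equally desirable. -/
def EquallyDesirable (v : SimpleGame n) (i j : Fin n) : Prop :=
  ∀ S : Finset (Fin n), i ∉ S → j ∉ S → (insert j S ∈ v.wins ↔ insert i S ∈ v.wins)

/-- The nontrivial symmetry classes: the classes of equally desirable voters that are not
dummies. -/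
def nontrivialClasses (v : SimpleGame n) : Set (Set (Fin n)) :=
  {C | ∃ i, ¬ v.IsDummy i ∧ C = {j | v.EquallyDesirable i j}}

/-- A minimal element, in `M(n)`, of the set of winning coalitions. -/
def IsShiftMinimalWinning (v : SimpleGame n) (A : Finset (Fin n)) : Prop :=
  A ∈ v.wins ∧ ∀ C ∈ v.wins, ShiftLE C A → C = A

/-- A maximal element, in `M(n)`, of the set of losing coalitions. -/
def IsShiftMaximalLosing (v : SimpleGame n) (B : Finset (Fin n)) : Prop :=
  B ∉ v.wins ∧ ∀ C, C ∉ v.wins → ShiftLE B C → C = B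

/-- `v` is the game `⟨N⟩` generated by the grand coalition. -/
def IsTopGame (v : SimpleGame n) : Prop := v.wins = generatedBy Finset.univ

/-- `v` is the game `⟨1⟩` generated by the coalition consisting of voter `1` alone. -/
def IsBottomGame (v : SimpleGame n) : Prop :=
  ∃ h : 0 < n, v.wins = generatedBy {⟨0, h⟩}

end SimpleGame

/-- The weighted games on `n` voters. -/
def WeightedGame (n : ℕ) : Type := {v : SimpleGame n // v.IsWeighted}

/-- `Step u v`: the game `u` arises from `v` by declaring exactly one losing coalition of `v` to be
winning. -/
def WeightedGame.Step {n : ℕ} (u v : WeightedGame n) : Prop :=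
  ∃ A, A ∉ v.1.wins ∧ u.1.wins = insert A v.1.wins

theorem WeightedGame.wins_subset {n : ℕ} {u v : WeightedGame n}
    (h : Relation.ReflTransGen WeightedGame.Step u v) : v.1.wins ⊆ u.1.wins := by
  induction h with
  | refl => exact subset_rfl
  | tail _ hs ih =>
    obtain ⟨A, _, hA⟩ := hs
    exact fun C hC => ih (hA ▸ Set.mem_insert_of_mem A hC)

/-- The poset `𝒲_n` of weighted games, with the partial ordering generated by the relation `Step`;
the greater game has fewer winning coalitions. -/
instance (n : ℕ) : PartialOrder (WeightedGame n) where
  le := Relation.ReflTransGen WeightedGame.Step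
  le_refl _ := Relation.ReflTransGen.refl
  le_trans _ _ _ := Relation.ReflTransGen.trans
  le_antisymm _ _ h₁ h₂ := Subtype.ext (SimpleGame.ext
    (Set.Subset.antisymm (WeightedGame.wins_subset h₂) (WeightedGame.wins_subset h₁)))

/-- The degree of `v` in the Hasse diagram of `𝒲_n`. -/
noncomputable def hasseDegree {n : ℕ} (v : WeightedGame n) : ℕ :=
  ((SimpleGraph.hasse (WeightedGame n)).neighborSet v).ncard

/-- The simplex `Δ_n` of normalized weights. -/
def normalizedWeights (n : ℕ) : Set (Fin n → ℝ) :=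
  {w | (∀ i, 0 ≤ w i) ∧ Monotone w ∧ ∑ i, w i = 1}

/-- The vertices of `Δ_n`: in `simplexVertex m` the `m + 1` strongest voters have weight
`1 / (m + 1)` each, and the others have weight `0`. -/
noncomputable def simplexVertex {n : ℕ} (m : Fin n) : Fin n → ℝ :=
  fun i => if i.rev ≤ m then 1 / ((m : ℝ) + 1) else 0

/-- The configuration region `(0, 1] × Δ_n`; its points are the pairs `(q, w)`. -/
def configurationRegion (n : ℕ) : Set (ℝ × (Fin n → ℝ)) :=
  Ioc (0 : ℝ) 1 ×ˢ normalizedWeights n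

/-- The polytope `P_v`: all realizations of `v` in the configuration region. -/
def polytope {n : ℕ} (v : SimpleGame n) : Set (ℝ × (Fin n → ℝ)) :=
  {x | x ∈ configurationRegion n ∧
    ∀ A : Finset (Fin n), A ∈ v.wins ↔ x.1 ≤ coalitionWeight x.2 A}

/-- The hyperplane `h_A` with equation `q = w_A`. -/
def hyperplane {n : ℕ} (A : Finset (Fin n)) : Set (ℝ × (Fin n → ℝ)) :=
  {x | x.1 = coalitionWeight x.2 A}

/-- `F` is a facet of the (not necessarily closed) convex polytope `K`: a nonempty exposed face of
the closure of `K`, of dimension one less than that of `K`. -/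
def IsFacet {E : Type*} [NormedAddCommGroup E] [NormedSpace ℝ E] (K F : Set E) : Prop :=
  F.Nonempty ∧ IsExposed ℝ (closure K) F ∧
    Module.finrank ℝ (vectorSpan ℝ F) + 1 = Module.finrank ℝ (vectorSpan ℝ K)

/-- Top facets lie in `h_A` for a winning coalition `A`; their (relative) interior is contained in
the polytope. -/
def IsTopFacet {n : ℕ} (v : SimpleGame n) (F : Set (ℝ × (Fin n → ℝ))) : Prop :=
  IsFacet (polytope v) F ∧ (∃ A ∈ v.wins, F ⊆ hyperplane A) ∧
    intrinsicInterior ℝ F ⊆ polytope v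

/-- Bottom facets lie in `h_B` for a losing coalition `B`; they are disjoint from the polytope. -/
def IsBottomFacet {n : ℕ} (v : SimpleGame n) (F : Set (ℝ × (Fin n → ℝ))) : Prop :=
  IsFacet (polytope v) F ∧ (∃ B, B ∉ v.wins ∧ F ⊆ hyperplane B) ∧
    Disjoint F (polytope v)

/-- Vertical facets lie above a codimension one subsimplex of `Δ_n` (spanned by all vertices but
one); their (relative) interior is contained in the polytope. -/
def IsVerticalFacet {n : ℕ} (v : SimpleGame n) (F : Set (ℝ × (Fin n → ℝ))) : Prop :=
  IsFacet (polytope v) F ∧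
    (∃ m : Fin n, ∀ x ∈ F, x.2 ∈ convexHull ℝ (simplexVertex '' {m}ᶜ)) ∧
    intrinsicInterior ℝ F ⊆ polytope v

open Classical in
/-- The number of the two statements `v = ⟨N⟩` and `v = ⟨1⟩` that are true. -/
noncomputable def extremalCount {n : ℕ} (v : SimpleGame n) : ℕ :=
  (if v.IsTopGame then 1 else 0) + (if v.IsBottomGame then 1 else 0)

end WeightedVoting

open WeightedVoting

/-! On the hyperplane where the total weight is 1, `P_v` is cut out by finitely many linear
inequalities: weak ones `q ≤ w_A` for winning `A`, strict ones `w_B < q` for losing `B`, and weak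
ones saying that the weakest weight and the consecutive differences (gaps) are nonnegative. It lies
between the slices given by the all-strict and the all-weak versions, and the all-strict slice is
nonempty (`exists_mem_strictSlice`). No two of these linear forms are positively proportional. So
facets correspond bijectively to the inequalities that can be tight alone, that is, at some point
where all others are strict (`isFacet_polytope_iff`, `face_injOn`). Winning, losing and gap
inequalities give top, bottom and vertical facets.

If `u` and `v` differ by one coalition `A`, a segment joining strict realizations of the two games
crosses `h_A` where only `A` is tight (`exists_mem_facetWins_of_step`). Conversely, at a point where
only `A` is tight, declaring `A` losing (after a small rise of the quota) or winning gives a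
neighbour in the Hasse diagram. This fails only for `N` in `⟨N⟩` and `∅` in `⟨1⟩`, whence `ε`.

A gap can be tight alone exactly when the voter is equally desirable as its predecessor, or is a
dummy first voter (`inr_mem_facetIndices_iff`). Symmetry classes are intervals, so the remaining
voters are the least members of the nontrivial classes, and `n - k` gaps carry facets. -/

namespace WeightedVoting

open Filter Topology

/-! ### Facets of a set between the strict and the weak slice of a polyhedral cone. -/

section Polyhedron

variable {E : Type*} [NormedAddCommGroup E] [NormedSpace ℝ E] {ι : Type*}

/-- The slice, by the hyperplane `s = 1`, of the cone defined by the inequalities `0 ≤ c j`. -/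
def coneSlice (s : E →L[ℝ] ℝ) (c : ι → E →L[ℝ] ℝ) : Set E := {x | s x = 1 ∧ ∀ j, 0 ≤ c j x}

/-- The points of the slice at which all inequalities are strict. -/
def strictSlice (s : E →L[ℝ] ℝ) (c : ι → E →L[ℝ] ℝ) : Set E := {x | s x = 1 ∧ ∀ j, 0 < c j x}

/-- The face of the slice on which the inequality `j` is tight. -/
def tightFace (s : E →L[ℝ] ℝ) (c : ι → E →L[ℝ] ℝ) (j : ι) : Set E :=
  {x | x ∈ coneSlice s c ∧ c j x = 0}

/-- At `y`, the inequality `j` is tight, and it is the only one. -/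
def IsTightAlone (s : E →L[ℝ] ℝ) (c : ι → E →L[ℝ] ℝ) (j : ι) (y : E) : Prop :=
  s y = 1 ∧ c j y = 0 ∧ ∀ k, k ≠ j → 0 < c k y

variable {s : E →L[ℝ] ℝ} {c : ι → E →L[ℝ] ℝ}

theorem IsTightAlone.mem_tightFace {j : ι} {y : E} (h : IsTightAlone s c j y) :
    y ∈ tightFace s c j := by
  refine ⟨⟨h.1, fun k => ?_⟩, h.2.1⟩
  by_cases hk : k = j
  · rw [hk, h.2.1]
  · exact (h.2.2 k hk).le

theorem IsTightAlone.eq_of_eq_zero {j k : ι} {y : E} (h : IsTightAlone s c j y)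
    (hk : c k y = 0) : k = j := by
  by_contra hne
  exact (h.2.2 k hne).ne' hk

theorem tightFace_injOn :
    InjOn (tightFace s c) {j | ∃ y, IsTightAlone s c j y} := by
  rintro j ⟨y, hy⟩ k _ hjk
  have h : y ∈ tightFace s c k := hjk ▸ hy.mem_tightFace
  exact (hy.eq_of_eq_zero h.2).symm

theorem convex_coneSlice : Convex ℝ (coneSlice s c) := by
  intro x hx y hy a b ha hb hab
  refine ⟨by simp [hx.1, hy.1, hab], fun j => ?_⟩
  have h1 := mul_nonneg ha (hx.2 j)
  have h2 := mul_nonneg hb (hy.2 j)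
  simpa using add_nonneg h1 h2

theorem isClosed_coneSlice : IsClosed (coneSlice s c) := by
  have : coneSlice s c = {x | s x = 1} ∩ ⋂ j, {x | 0 ≤ c j x} := by
    ext x; simp [coneSlice]
  rw [this]
  exact (isClosed_eq s.continuous continuous_const).inter
    (isClosed_iInter fun j => isClosed_le continuous_const (c j).continuous)

/-- By continuity, finitely many strict inequalities survive a short move. This is the perturbation
tool for all later arguments. -/
theorem exists_pos_forall_pos_add_smul [Finite ι] (c : ι → E →L[ℝ] ℝ) (y d : E) :
    ∃ t : ℝ, 0 < t ∧ ∀ k, 0 < c k y → 0 < c k (y + t • d) := by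
  have h : ∀ᶠ t : ℝ in 𝓝[>] 0, ∀ k, 0 < c k y → 0 < c k (y + t • d) := by
    rw [eventually_all]
    intro k
    by_cases hk : 0 < c k y
    · have hc : Tendsto (fun t : ℝ => c k (y + t • d)) (𝓝 0) (𝓝 (c k y)) := by
        have : Continuous fun t : ℝ => c k (y + t • d) := by fun_prop
        simpa using this.tendsto 0
      filter_upwards [(hc.eventually_const_lt hk).filter_mono nhdsWithin_le_nhds] with t ht _
      exact ht
    · exact Eventually.of_forall fun t h => absurd h hk
  obtain ⟨t, ht, ht0⟩ := (h.and self_mem_nhdsWithin).exists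
  exact ⟨t, ht0, ht⟩

theorem le_vectorSpan_of_exists_add_smul_mem {S : Set E} {V : Submodule ℝ E} {y : E} (hy : y ∈ S)
    (h : ∀ d ∈ V, ∃ t : ℝ, 0 < t ∧ y + t • d ∈ S) : V ≤ vectorSpan ℝ S := by
  intro d hd
  obtain ⟨t, ht, hm⟩ := h d hd
  have h1 := vsub_mem_vectorSpan ℝ hm hy
  simp only [vsub_eq_sub, add_sub_cancel_left] at h1
  have h2 := (vectorSpan ℝ S).smul_mem t⁻¹ h1
  rwa [smul_smul, inv_mul_cancel₀ ht.ne', one_smul] at h2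

theorem vectorSpan_le_ker_of_forall_eq {S : Set E} {f : E →L[ℝ] ℝ} {a : ℝ}
    (h : ∀ x ∈ S, f x = a) : vectorSpan ℝ S ≤ LinearMap.ker f.toLinearMap := by
  rw [vectorSpan_def, Submodule.span_le]
  rintro _ ⟨x, hx, y, hy, rfl⟩
  simp [h x hx, h y hy]

theorem vectorSpan_eq_ker_of_strictSlice_subset [Finite ι] {K : Set E}
    (h1 : strictSlice s c ⊆ K) (h2 : K ⊆ coneSlice s c) (h0 : (strictSlice s c).Nonempty) :
    vectorSpan ℝ K = LinearMap.ker s.toLinearMap := by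
  obtain ⟨x, hx⟩ := h0
  refine le_antisymm (vectorSpan_le_ker_of_forall_eq fun z hz => (h2 hz).1)
    (le_vectorSpan_of_exists_add_smul_mem (h1 hx) fun d hd => ?_)
  obtain ⟨t, ht, h⟩ := exists_pos_forall_pos_add_smul c x d
  have hd' : s d = 0 := hd
  exact ⟨t, ht, h1 ⟨by simp [hx.1, hd'], fun k => h k (hx.2 k)⟩⟩

/-- On the segment from a point of the weak slice to a strict point, every point but the first is
strict. -/
theorem closure_eq_coneSlice {K : Set E}
    (h1 : strictSlice s c ⊆ K) (h2 : K ⊆ coneSlice s c) (h0 : (strictSlice s c).Nonempty) :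
    closure K = coneSlice s c := by
  refine (closure_minimal h2 isClosed_coneSlice).antisymm fun z hz => ?_
  obtain ⟨x, hx⟩ := h0
  refine closure_mono h1 (mem_closure_of_tendsto (b := 𝓝[>] (0 : ℝ))
    (f := fun t : ℝ => z + t • (x - z)) ?_ ?_)
  · have : Continuous fun t : ℝ => z + t • (x - z) := by fun_prop
    simpa using (this.tendsto 0).mono_left nhdsWithin_le_nhds
  · have h01 : Ioo (0 : ℝ) 1 ∈ 𝓝[>] (0 : ℝ) := Ioo_mem_nhdsGT one_pos
    filter_upwards [h01] with t ht
    refine ⟨by simp [hx.1, hz.1], fun k => ?_⟩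
    have e : c k (z + t • (x - z)) = (1 - t) * c k z + t * c k x := by
      simp only [map_add, map_smul, map_sub, smul_eq_mul]; ring
    rw [e]
    have := mul_nonneg (sub_nonneg.2 ht.2.le) (hz.2 k)
    have := mul_pos ht.1 (hx.2 k)
    linarith

/-- The form `f` does not vanish on `x - y`, which lies in the kernel of `s`, so it cuts the
dimension of that kernel by one. -/
theorem finrank_ker_inf_ker_add_one [FiniteDimensional ℝ E] {f : E →L[ℝ] ℝ} {x y : E}
    (hs : s x = s y) (hf : f x ≠ f y) :
    Module.finrank ℝ ↥(LinearMap.ker s.toLinearMap ⊓ LinearMap.ker f.toLinearMap) + 1 =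
      Module.finrank ℝ (LinearMap.ker s.toLinearMap) := by
  set V := LinearMap.ker s.toLinearMap
  have hne : f.toLinearMap.domRestrict V ≠ 0 := by
    intro h
    have hm : x - y ∈ V := by simp [V, hs]
    have := LinearMap.congr_fun h ⟨x - y, hm⟩
    simp [sub_eq_zero] at this
    exact hf this
  have h1 := Module.Dual.finrank_ker_add_one_of_ne_zero (f := f.toLinearMap.domRestrict V) hne
  have h2 : V ⊓ LinearMap.ker f.toLinearMap
      = (LinearMap.ker (f.toLinearMap.domRestrict V)).map V.subtype := by
    ext z
    simp [Submodule.mem_map, LinearMap.mem_ker, and_comm]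
  rw [h2, Submodule.finrank_map_subtype_eq, h1]

theorem add_smul_mem_tightFace [Finite ι] {j : ι} {y d : E} (hy : IsTightAlone s c j y)
    (hs : s d = 0) (hj : c j d = 0) : ∃ t : ℝ, 0 < t ∧ y + t • d ∈ tightFace s c j := by
  obtain ⟨t, ht, h⟩ := exists_pos_forall_pos_add_smul c y d
  refine ⟨t, ht, IsTightAlone.mem_tightFace
    ⟨by simp [hy.1, hs], by simp [hy.2.1, hj], fun k hk => h k (hy.2.2 k hk)⟩⟩

theorem vectorSpan_tightFace [Finite ι] {j : ι} {y : E} (hy : IsTightAlone s c j y) :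
    vectorSpan ℝ (tightFace s c j) =
      LinearMap.ker s.toLinearMap ⊓ LinearMap.ker (c j).toLinearMap :=
  le_antisymm
    (le_inf (vectorSpan_le_ker_of_forall_eq fun _ hx => hx.1.1)
      (vectorSpan_le_ker_of_forall_eq fun _ hx => hx.2))
    (le_vectorSpan_of_exists_add_smul_mem hy.mem_tightFace fun _ hd =>
      add_smul_mem_tightFace hy hd.1 hd.2)

/-- The functional `-c j` exposes the face: its maximum over the slice is 0, attained at `y`. The
dimension is right because around `y` the face fills the common kernel of `s` and `c j`. -/
theorem isFacet_tightFace [Finite ι] [FiniteDimensional ℝ E] {K : Set E}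
    (h1 : strictSlice s c ⊆ K) (h2 : K ⊆ coneSlice s c) (h0 : (strictSlice s c).Nonempty)
    {j : ι} {y : E} (hy : IsTightAlone s c j y) : IsFacet K (tightFace s c j) := by
  refine ⟨⟨y, hy.mem_tightFace⟩, fun _ => ⟨-c j, ?_⟩, ?_⟩
  · rw [closure_eq_coneSlice h1 h2 h0]
    ext x
    constructor
    · rintro ⟨hx, hx0⟩
      exact ⟨hx, fun z hz => by simpa [hx0] using hz.2 j⟩
    · rintro ⟨hx, hmax⟩
      have := hmax y hy.mem_tightFace.1
      simp only [neg_apply, hy.2.1] at this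
      exact ⟨hx, le_antisymm (by linarith) (hx.2 j)⟩
  · obtain ⟨x, hx⟩ := h0
    rw [vectorSpan_tightFace hy, vectorSpan_eq_ker_of_strictSlice_subset h1 h2 ⟨x, hx⟩]
    exact finrank_ker_inf_ker_add_one (x := x) (y := y) (hx.1.trans hy.1.symm)
      (by rw [hy.2.1]; exact (hx.2 j).ne')

/-- A nonempty convex part of the slice has a point at which only those inequalities are tight
that are tight on all of it. -/
theorem exists_mem_forall_pos_of_convex [Finite ι] {F : Set E} (hF : Convex ℝ F)
    (hne : F.Nonempty) (hsub : F ⊆ coneSlice s c) :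
    ∃ y ∈ F, ∀ k, (∃ x ∈ F, c k x ≠ 0) → 0 < c k y := by
  have key : ∀ T : Set ι, T.Finite → ∃ y ∈ F, ∀ k ∈ T, (∃ x ∈ F, c k x ≠ 0) → 0 < c k y := by
    intro T hT
    induction T, hT using Set.Finite.induction_on with
    | empty => exact ⟨hne.some, hne.some_mem, by simp⟩
    | @insert a T _ _ ih =>
      obtain ⟨y, hy, h⟩ := ih
      by_cases ha : ∃ x ∈ F, c a x ≠ 0
      · obtain ⟨x, hx, hxa⟩ := ha
        -- The midpoint is strict wherever `x` or `y` is.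
        refine ⟨(1 / 2 : ℝ) • x + (1 / 2 : ℝ) • y, hF hx hy (by norm_num) (by norm_num)
          (by norm_num), fun k hk hk' => ?_⟩
        have e : c k ((1 / 2 : ℝ) • x + (1 / 2 : ℝ) • y) = (c k x + c k y) / 2 := by
          simp only [map_add, map_smul, smul_eq_mul]; ring
        rw [e]
        have hxk := (hsub hx).2 k
        have hyk := (hsub hy).2 k
        rcases hk with rfl | hk
        · have := lt_of_le_of_ne hxk (Ne.symm hxa)
          linarith
        · have := h k hk hk'
          linarith
      · refine ⟨y, hy, fun k hk hk' => ?_⟩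
        rcases hk with rfl | hk
        · exact absurd hk' ha
        · exact h k hk hk'
  obtain ⟨y, hy, h⟩ := key univ finite_univ
  exact ⟨y, hy, fun k => h k (mem_univ k)⟩

/-- Take `y` in `F` with as few tight constraints as possible. For dimension reasons some constraint
vanishes on all of `F`; a second one would have the same kernel inside that of `s`, and hence be
proportional to the first. -/
theorem exists_eq_tightFace_of_isFacet [Finite ι] [FiniteDimensional ℝ E] {K : Set E}
    (h1 : strictSlice s c ⊆ K) (h2 : K ⊆ coneSlice s c) (h0 : (strictSlice s c).Nonempty)
    (hc : ∀ j k, j ≠ k → ∀ a : ℝ, 0 < a → c k ≠ a • c j)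
    {F : Set E} (hF : IsFacet K F) :
    ∃ j, (∃ y, IsTightAlone s c j y) ∧ F = tightFace s c j := by
  obtain ⟨hne, hexp, hdim⟩ := hF
  rw [vectorSpan_eq_ker_of_strictSlice_subset h1 h2 h0] at hdim
  rw [closure_eq_coneSlice h1 h2 h0] at hexp
  have hsub : F ⊆ coneSlice s c := hexp.subset
  have hconv : Convex ℝ F := hexp.convex convex_coneSlice
  obtain ⟨l, hl⟩ := hexp hne
  obtain ⟨x, hx⟩ := h0
  obtain ⟨y, hy, hpos⟩ := exists_mem_forall_pos_of_convex hconv hne hsub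
  have hmax : ∀ z ∈ coneSlice s c, l z ≤ l y := (hl ▸ hy : y ∈ {x | _ ∧ _}).2
  have hmem : ∀ z ∈ coneSlice s c, l y ≤ l z → z ∈ F := fun z hz hle => by
    rw [hl]; exact ⟨hz, fun w hw => (hmax w hw).trans hle⟩
  have hys : s y = 1 := (hsub hy).1
  -- otherwise the linear form `l` is constant on the slice
  have hT : ∃ j, ∀ z ∈ F, c j z = 0 := by
    by_contra! hcon
    have hstr : ∀ k, 0 < c k y := fun k => hpos k (hcon k)
    -- With nothing tight at `y`, one can move along both `d` and `-d`. Maximality of `l` at `y`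
    -- against `-d` gives `l d ≥ 0`, so the move along `d` stays in `F`, which would then have full
    -- dimension.
    have hker : LinearMap.ker s.toLinearMap ≤ vectorSpan ℝ F := by
      refine le_vectorSpan_of_exists_add_smul_mem hy fun d hd => ?_
      have hd' : s d = 0 := hd
      obtain ⟨t, ht, hp⟩ := exists_pos_forall_pos_add_smul c y d
      obtain ⟨t', ht', hp'⟩ := exists_pos_forall_pos_add_smul c y (-d)
      have m1 : y + t • d ∈ coneSlice s c :=
        ⟨by simp [hys, hd'], fun k => (hp k (hstr k)).le⟩
      have m2 : y + t' • (-d) ∈ coneSlice s c :=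
        ⟨by simp [hys, hd'], fun k => (hp' k (hstr k)).le⟩
      have b2 := hmax _ m2
      simp only [map_add, map_smul, map_neg, smul_eq_mul] at b2
      have hld : 0 ≤ l d := by
        have : 0 ≤ t' * l d := by linarith
        exact nonneg_of_mul_nonneg_right this ht'
      refine ⟨t, ht, hmem _ m1 ?_⟩
      simp only [map_add, map_smul, smul_eq_mul]
      have := mul_nonneg ht.le hld
      linarith
    have := Submodule.finrank_mono hker
    omega
  obtain ⟨j, hj⟩ := hT
  have hspan : ∀ k, (∀ z ∈ F, c k z = 0) →
      vectorSpan ℝ F = LinearMap.ker s.toLinearMap ⊓ LinearMap.ker (c k).toLinearMap := by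
    intro k hk
    refine Submodule.eq_of_le_of_finrank_eq
      (le_inf (vectorSpan_le_ker_of_forall_eq fun z hz => (hsub hz).1)
        (vectorSpan_le_ker_of_forall_eq hk)) ?_
    have := finrank_ker_inf_ker_add_one (s := s) (f := c k) (x := x) (y := y)
      (hx.1.trans hys.symm) (by rw [hk y hy]; exact (hx.2 k).ne')
    omega
  have hy' : IsTightAlone s c j y := by
    refine ⟨hys, hj y hy, fun k hk => ?_⟩
    by_contra hcon
    have hk0 : ∀ z ∈ F, c k z = 0 := by
      by_contra! hz
      exact hcon (hpos k hz)
    have heq := (hspan j hj).symm.trans (hspan k hk0)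
    have hprop : ∀ z, c k z = (c k x / c j x) * c j z := by
      intro z
      have hxj := (hx.2 j).ne'
      -- Since `s x = s y = 1` and `c j y = 0`, these coefficients project `z` along `x` and `y`
      -- into the common kernel. As `c k y = 0` too, applying `c k` yields the proportionality.
      have hm : z - (c j z / c j x) • x - (s z - c j z / c j x) • y ∈
          LinearMap.ker s.toLinearMap ⊓ LinearMap.ker (c j).toLinearMap := by
        constructor
        · simp [hx.1, hys]
        · simp [hj y hy, hxj]
      rw [heq] at hm
      have : c k (z - (c j z / c j x) • x - (s z - c j z / c j x) • y) = 0 := hm.2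
      simp only [map_sub, map_smul, smul_eq_mul,
        hk0 y hy] at this
      have e : c k x / c j x * c j z = c j z / c j x * c k x := by ring
      rw [e]
      linarith
    exact hc j k hk.symm _ (div_pos (hx.2 k) (hx.2 j)) (ContinuousLinearMap.ext hprop)
  refine ⟨j, ⟨y, hy'⟩, Subset.antisymm (fun z hz => ⟨hsub hz, hj z hz⟩) ?_⟩
  rintro z ⟨hz, hzj⟩
  -- The segment from `z` to `y` extends beyond `y` within the face. Since `l` is maximal at `y`, it
  -- cannot be smaller at `z`.
  obtain ⟨t, ht, hm⟩ := add_smul_mem_tightFace hy' (d := y - z) (by simp [hys, hz.1])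
    (by simp [hy'.2.1, hzj])
  have hb := hmax _ hm.1
  simp only [map_add, map_smul, map_sub, smul_eq_mul] at hb
  refine hmem z hz ?_
  have : 0 ≤ t * (l z - l y) := by linarith
  have := nonneg_of_mul_nonneg_right this ht
  linarith

theorem exists_pos_add_smul_mem_of_mem_intrinsicInterior {F : Set E} {x y : E}
    (hx : x ∈ intrinsicInterior ℝ F) (hy : y ∈ F) :
    ∃ t : ℝ, 0 < t ∧ x + t • (x - y) ∈ F := by
  obtain ⟨x', hx', rfl⟩ := hx
  have hmem : ∀ t : ℝ, (x' : E) + t • ((x' : E) - y) ∈ affineSpan ℝ F := fun t => by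
    have := AffineSubspace.vadd_mem_of_mem_direction
      ((affineSpan ℝ F).direction.smul_mem t
        (AffineSubspace.vsub_mem_direction x'.2 (mem_affineSpan ℝ hy))) x'.2
    simpa [add_comm] using this
  have hcont : Continuous fun t : ℝ => (⟨(x' : E) + t • ((x' : E) - y), hmem t⟩ : affineSpan ℝ F) :=
    Continuous.subtype_mk (by fun_prop) _
  have hev : ∀ᶠ t : ℝ in 𝓝 0, (x' : E) + t • ((x' : E) - y) ∈ F := by
    refine hcont.continuousAt.preimage_mem_nhds (t := ((↑) ⁻¹' F : Set (affineSpan ℝ F))) ?_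
    simpa using mem_interior_iff_mem_nhds.1 hx'
  obtain ⟨t, h, h0⟩ := ((hev.filter_mono (nhdsWithin_le_nhds (s := Ioi 0))).and
    self_mem_nhdsWithin).exists
  exact ⟨t, h0, h⟩

/-- Push `x` slightly away from `y` within the face: a form that is positive at `y` and nonnegative
at the new point is positive at `x`, which lies between them. -/
theorem isTightAlone_of_mem_intrinsicInterior {j : ι} {x y : E} (hy : IsTightAlone s c j y)
    (hx : x ∈ intrinsicInterior ℝ (tightFace s c j)) : IsTightAlone s c j x := by
  have hxF := intrinsicInterior_subset hx
  refine ⟨hxF.1.1, hxF.2, fun k hk => ?_⟩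
  obtain ⟨t, ht, hm⟩ := exists_pos_add_smul_mem_of_mem_intrinsicInterior hx hy.mem_tightFace
  have h1 := hm.1.2 k
  simp only [map_add, map_smul, map_sub, smul_eq_mul] at h1
  have h2 := mul_pos ht (hy.2.2 k hk)
  have : 0 < (1 + t) * c k x := by linarith
  exact pos_of_mul_pos_right this (by linarith)

end Polyhedron


/-! ### Gap coordinates on the simplex of weights. -/

section Gaps

variable {n : ℕ}

/-- The linear form `w i - w (i - 1)`, or `w 0` when `i = 0`. -/
noncomputable def gapForm (i : Fin n) : (Fin n → ℝ) →L[ℝ] ℝ :=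
  ContinuousLinearMap.proj (R := ℝ) (φ := fun _ : Fin n => ℝ) i -
    if (i : ℕ) = 0 then 0 else
      ContinuousLinearMap.proj (R := ℝ) (φ := fun _ : Fin n => ℝ) (⟨i - 1, (Nat.sub_le _ _).trans_lt i.2⟩ : Fin n)

theorem gapForm_zero (h : 0 < n) (w : Fin n → ℝ) : gapForm ⟨0, h⟩ w = w ⟨0, h⟩ := by
  simp [gapForm]

theorem gapForm_succ {i : ℕ} (h : i + 1 < n) (w : Fin n → ℝ) :
    gapForm ⟨i + 1, h⟩ w = w ⟨i + 1, h⟩ - w ⟨i, Nat.lt_of_succ_lt h⟩ := by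
  simp [gapForm]

theorem nonneg_of_gapForm {w : Fin n → ℝ} (h : ∀ i, 0 ≤ gapForm i w) (i : Fin n) : 0 ≤ w i := by
  obtain ⟨i, hi⟩ := i
  induction i with
  | zero => exact gapForm_zero hi w ▸ h _
  | succ i ih =>
    have h1 := ih (Nat.lt_of_succ_lt hi)
    have h2 := h ⟨i + 1, hi⟩
    rw [gapForm_succ] at h2
    linarith

theorem monotone_of_gapForm {w : Fin n → ℝ} (h : ∀ i, 0 ≤ gapForm i w) : Monotone w := by
  rintro ⟨i, hi⟩ ⟨j, hj⟩ hij
  have hij' : i ≤ j := hij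
  clear hij
  induction j, hij' using Nat.le_induction with
  | base => exact le_rfl
  | succ j _ ih =>
    have h1 := ih (Nat.lt_of_succ_lt hj)
    have h2 := h ⟨j + 1, hj⟩
    rw [gapForm_succ] at h2
    linarith

theorem gapForm_nonneg {w : Fin n → ℝ} (h : ∀ i, 0 ≤ w i) (hm : Monotone w) (i : Fin n) :
    0 ≤ gapForm i w := by
  obtain ⟨i, hi⟩ := i
  cases i with
  | zero => rw [gapForm_zero]; exact h _
  | succ i =>
    rw [gapForm_succ, sub_nonneg]
    exact hm (Fin.mk_le_mk.2 (Nat.le_succ i))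

theorem eq_of_gapForm_eq {w w' : Fin n → ℝ} (h : ∀ i, gapForm i w = gapForm i w') : w = w' := by
  funext ⟨i, hi⟩
  induction i with
  | zero => simpa [gapForm_zero] using h ⟨0, hi⟩
  | succ i ih =>
    have h1 := ih (Nat.lt_of_succ_lt hi)
    have h2 := h ⟨i + 1, hi⟩
    rw [gapForm_succ, gapForm_succ] at h2
    linarith

/-- The weights of a vertex jump only at its weakest voter of positive weight. Up to scaling, the
vertices thus form the basis dual to the gaps, and the gaps give barycentric coordinates. -/
theorem gapForm_simplexVertex (m i : Fin n) :
    gapForm i (simplexVertex m) = if m = i.rev then 1 / ((m : ℝ) + 1) else 0 := by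
  obtain ⟨i, hi⟩ := i
  obtain ⟨m, hm⟩ := m
  cases i with
  | zero =>
    simp only [gapForm_zero, simplexVertex, Fin.le_def, Fin.ext_iff, Fin.val_rev]
    have : n - (0 + 1) ≤ m ↔ m = n - (0 + 1) := by omega
    simp only [this]
  | succ i =>
    simp only [gapForm_succ, simplexVertex, Fin.le_def, Fin.ext_iff, Fin.val_rev]
    by_cases h1 : n - (i + 1) ≤ m
    · rw [if_pos (by omega), if_pos h1, if_neg (by omega), sub_self]
    · rw [if_neg h1, sub_zero]
      have : n - (i + 1 + 1) ≤ m ↔ m = n - (i + 1 + 1) := by omega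
      simp only [this]

theorem sum_simplexVertex (m : Fin n) : ∑ i, simplexVertex m i = 1 := by
  have h : ∑ i : Fin n, simplexVertex m i
      = ∑ i : Fin n, if i ≤ m then 1 / ((m : ℝ) + 1) else 0 :=
    Fintype.sum_equiv Fin.revPerm _ _ fun i => by simp [simplexVertex]
  have hc : (Finset.univ.filter fun i : Fin n => i ≤ m) = Finset.Iic m := by ext; simp
  rw [h, ← Finset.sum_filter, hc, Finset.sum_const, Fin.card_Iic]
  have : (m : ℝ) + 1 ≠ 0 := by positivity
  simp only [nsmul_eq_mul]
  push_cast
  field_simp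

theorem sum_smul_simplexVertex (w : Fin n → ℝ) :
    ∑ m : Fin n, (((m : ℝ) + 1) * gapForm m.rev w) • simplexVertex m = w := by
  refine eq_of_gapForm_eq fun i => ?_
  rw [map_sum, Finset.sum_eq_single i.rev]
  · have : ((i.rev : Fin n) : ℝ) + 1 ≠ 0 := by positivity
    simp only [map_smul, gapForm_simplexVertex, if_true, smul_eq_mul, Fin.rev_rev]
    field_simp
  · intro m _ hm
    simp [gapForm_simplexVertex, hm]
  · simp

theorem mem_convexHull_of_gapForm_eq_zero {w : Fin n → ℝ} (h : ∀ i, 0 ≤ gapForm i w)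
    (hs : ∑ i, w i = 1) {m : Fin n} (hm : gapForm m.rev w = 0) :
    w ∈ convexHull ℝ (simplexVertex '' {m}ᶜ) := by
  have hz : ∀ k ∈ (Finset.univ : Finset (Fin n)), k ∉ Finset.univ.erase m →
      ((k : ℝ) + 1) * gapForm k.rev w = 0 := by
    intro k _ hk
    have : k = m := by simpa using hk
    rw [this, hm, mul_zero]
  have hsum : ∑ k ∈ Finset.univ.erase m, ((k : ℝ) + 1) * gapForm k.rev w = 1 := by
    rw [Finset.sum_subset (Finset.erase_subset m Finset.univ) hz]
    refine Eq.trans ?_ hs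
    conv_rhs => rw [← sum_smul_simplexVertex w]
    simp only [Finset.sum_apply, Pi.smul_apply, smul_eq_mul]
    rw [Finset.sum_comm]
    refine Finset.sum_congr rfl fun k _ => ?_
    rw [← Finset.mul_sum, sum_simplexVertex, mul_one]
  have hw : ∑ k ∈ Finset.univ.erase m,
      (((k : ℝ) + 1) * gapForm k.rev w) • (simplexVertex k : Fin n → ℝ) = w := by
    rw [Finset.sum_subset (Finset.erase_subset m Finset.univ)
      fun k h1 h2 => by rw [hz k h1 h2, zero_smul]]
    exact sum_smul_simplexVertex w
  rw [← hw]
  refine (convex_convexHull ℝ _).sum_mem (fun k _ => mul_nonneg (by positivity) (h _)) hsum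
    fun k hk => subset_convexHull ℝ _ ⟨k, by simpa using hk, rfl⟩

theorem gapForm_eq_zero_of_mem_convexHull {w : Fin n → ℝ} {m : Fin n}
    (hw : w ∈ convexHull ℝ (simplexVertex '' {m}ᶜ)) : gapForm m.rev w = 0 := by
  have hconv : Convex ℝ {w : Fin n → ℝ | gapForm m.rev w = 0} := by
    intro x hx y hy a b _ _ _
    have hx' : gapForm m.rev x = 0 := hx
    have hy' : gapForm m.rev y = 0 := hy
    simp [hx', hy']
  refine convexHull_min ?_ hconv hw
  rintro _ ⟨k, hk, rfl⟩
  have : k ≠ m := hk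
  simp [gapForm_simplexVertex, this]

end Gaps

/-! ### The inequalities of `P_v` and its three kinds of facets. -/

section Constraints

variable {n : ℕ}

/-- The linear form `(q, w) ↦ w_A`. -/
noncomputable def weightForm (A : Finset (Fin n)) : (ℝ × (Fin n → ℝ)) →L[ℝ] ℝ :=
  ∑ i ∈ A, (ContinuousLinearMap.proj i).comp (ContinuousLinearMap.snd ℝ ℝ (Fin n → ℝ))

@[simp]
theorem weightForm_apply (A : Finset (Fin n)) (x : ℝ × (Fin n → ℝ)) :
    weightForm A x = coalitionWeight x.2 A := by
  simp [weightForm, coalitionWeight]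

open Classical in
/-- The linear forms that are nonnegative on the realizations of `v`: one for each coalition,
winning or losing, and one for each pair of consecutive weights. -/
noncomputable def constraint (v : SimpleGame n) :
    Finset (Fin n) ⊕ Fin n → (ℝ × (Fin n → ℝ)) →L[ℝ] ℝ
  | Sum.inl A => if A ∈ v.wins then weightForm A - ContinuousLinearMap.fst ℝ ℝ (Fin n → ℝ)
      else ContinuousLinearMap.fst ℝ ℝ (Fin n → ℝ) - weightForm A
  | Sum.inr i => (gapForm i).comp (ContinuousLinearMap.snd ℝ ℝ (Fin n → ℝ))

variable {v : SimpleGame n}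

theorem constraint_winning {A : Finset (Fin n)} (h : A ∈ v.wins) (x : ℝ × (Fin n → ℝ)) :
    constraint v (Sum.inl A) x = coalitionWeight x.2 A - x.1 := by
  simp [constraint, h]

theorem constraint_losing {A : Finset (Fin n)} (h : A ∉ v.wins) (x : ℝ × (Fin n → ℝ)) :
    constraint v (Sum.inl A) x = x.1 - coalitionWeight x.2 A := by
  simp [constraint, h]

@[simp]
theorem constraint_inr (i : Fin n) (x : ℝ × (Fin n → ℝ)) :
    constraint v (Sum.inr i) x = gapForm i x.2 := rfl

theorem constraint_inl_eq_zero_iff {A : Finset (Fin n)} {x : ℝ × (Fin n → ℝ)} :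
    constraint v (Sum.inl A) x = 0 ↔ x ∈ hyperplane A := by
  by_cases h : A ∈ v.wins
  · rw [constraint_winning h, sub_eq_zero, hyperplane, mem_ofPred_eq, eq_comm]
  · rw [constraint_losing h, sub_eq_zero, hyperplane, mem_ofPred_eq]

theorem coalitionWeight_empty (w : Fin n → ℝ) : coalitionWeight w ∅ = 0 := by
  simp [coalitionWeight]

/-- The face of the closure of the polytope on which the constraint `j` is tight. -/
noncomputable def face (v : SimpleGame n) (j : Finset (Fin n) ⊕ Fin n) :
    Set (ℝ × (Fin n → ℝ)) :=
  tightFace (weightForm Finset.univ) (constraint v) j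

/-- The constraints that define facets. -/
def facetIndices (v : SimpleGame n) : Set (Finset (Fin n) ⊕ Fin n) :=
  {j | ∃ y, IsTightAlone (weightForm Finset.univ) (constraint v) j y}

theorem mem_normalizedWeights_of_mem_coneSlice {x : ℝ × (Fin n → ℝ)}
    (hx : x ∈ coneSlice (weightForm Finset.univ) (constraint v)) :
    x.2 ∈ normalizedWeights n :=
  have hg : ∀ i, 0 ≤ gapForm i x.2 := fun i => hx.2 (Sum.inr i)
  ⟨nonneg_of_gapForm hg, monotone_of_gapForm hg,
    by simpa [coalitionWeight] using hx.1⟩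

/-- Only losing coalitions demand strict inequalities. The bounds `0 < q ≤ 1` come from `∅` losing
and `N` winning. -/
theorem mem_polytope_of_mem_coneSlice {x : ℝ × (Fin n → ℝ)}
    (hx : x ∈ coneSlice (weightForm Finset.univ) (constraint v))
    (hl : ∀ B, B ∉ v.wins → 0 < constraint v (Sum.inl B) x) : x ∈ polytope v := by
  have h0 := hl ∅ v.empty_notMem
  have h1 := hx.2 (Sum.inl Finset.univ)
  have hs := hx.1
  rw [weightForm_apply] at hs
  rw [constraint_losing v.empty_notMem, coalitionWeight_empty] at h0
  rw [constraint_winning v.univ_mem, hs] at h1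
  refine ⟨⟨⟨by linarith, by linarith⟩, mem_normalizedWeights_of_mem_coneSlice hx⟩,
    fun A => ⟨fun hA => ?_, fun hA => ?_⟩⟩
  · have := hx.2 (Sum.inl A)
    rw [constraint_winning hA] at this
    linarith
  · by_contra hB
    have := hl A hB
    rw [constraint_losing hB] at this
    linarith

theorem strictSlice_subset_polytope :
    strictSlice (weightForm Finset.univ) (constraint v) ⊆ polytope v := fun _ hx =>
  mem_polytope_of_mem_coneSlice ⟨hx.1, fun j => (hx.2 j).le⟩ fun _ _ => hx.2 _

theorem polytope_subset_coneSlice :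
    polytope v ⊆ coneSlice (weightForm Finset.univ) (constraint v) := by
  rintro x ⟨⟨-, h0, hm, hs⟩, hA⟩
  refine ⟨by simpa [coalitionWeight] using hs, ?_⟩
  rintro (A | i)
  · by_cases h : A ∈ v.wins
    · rw [constraint_winning h]
      linarith [(hA A).1 h]
    · rw [constraint_losing h]
      linarith [not_le.1 (mt (hA A).2 h)]
  · exact gapForm_nonneg h0 hm i

theorem weightForm_univ_pos {x : ℝ × (Fin n → ℝ)}
    (h : ∀ A, 0 < constraint v (Sum.inl A) x) : 0 < weightForm Finset.univ x := by
  have h0 := h ∅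
  have h1 := h Finset.univ
  rw [constraint_losing v.empty_notMem, coalitionWeight_empty] at h0
  rw [constraint_winning v.univ_mem] at h1
  rw [weightForm_apply]
  linarith

theorem inv_smul_mem_strictSlice {x : ℝ × (Fin n → ℝ)} (h : ∀ j, 0 < constraint v j x) :
    (weightForm Finset.univ x)⁻¹ • x ∈ strictSlice (weightForm Finset.univ) (constraint v) := by
  have hpos : 0 < weightForm Finset.univ x := weightForm_univ_pos fun A => h _
  refine ⟨by rw [map_smul, smul_eq_mul, inv_mul_cancel₀ hpos.ne'], fun j => ?_⟩
  rw [map_smul, smul_eq_mul]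
  exact mul_pos (inv_pos.2 hpos) (h j)

theorem gapForm_natCast_add_one (i : Fin n) :
    gapForm i (fun i : Fin n => (i : ℝ) + 1) = 1 := by
  obtain ⟨i, hi⟩ := i
  cases i with
  | zero => simp [gapForm_zero]
  | succ i => simp [gapForm_succ]

/-- Lowering the quota and adding multiples of the weights `1, …, n` makes the winning and gap
inequalities strict. A small step preserves the losing ones, which were strict already; then
normalize. -/
theorem exists_mem_strictSlice (hv : v.IsWeighted) :
    (strictSlice (weightForm Finset.univ) (constraint v)).Nonempty := by
  obtain ⟨q, w, h0, hm, -, -, hA⟩ := hv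
  obtain ⟨t, ht, hp⟩ := exists_pos_forall_pos_add_smul (constraint v) (q, w)
    (-1, fun i : Fin n => (i : ℝ) + 1)
  refine ⟨_, inv_smul_mem_strictSlice
    (x := (q, w) + t • (-1, fun i : Fin n => (i : ℝ) + 1)) ?_⟩
  rintro (A | i)
  · by_cases h : A ∈ v.wins
    · rw [map_add, map_smul, constraint_winning h, constraint_winning h]
      have h1 := (hA A).1 h
      have h2 : 0 ≤ coalitionWeight (fun i : Fin n => (i : ℝ) + 1) A :=
        Finset.sum_nonneg fun i _ => by positivity
      have h3 : 0 < t * (coalitionWeight (fun i : Fin n => (i : ℝ) + 1) A - -1) :=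
        mul_pos ht (by linarith)
      simp only [smul_eq_mul]
      linarith
    · refine hp _ ?_
      rw [constraint_losing h]
      have := not_le.1 (mt (hA A).2 h)
      simpa using this
  · rw [map_add, map_smul, constraint_inr, constraint_inr, gapForm_natCast_add_one]
    have := gapForm_nonneg h0 hm i
    simp only [smul_eq_mul]
    linarith

theorem gapForm_indicator (i k : Fin n) :
    gapForm k (fun m => if i ≤ m then (1 : ℝ) else 0) = if i = k then 1 else 0 := by
  obtain ⟨i, hi⟩ := i
  obtain ⟨k, hk⟩ := k
  cases k with
  | zero => simp [gapForm_zero, Fin.le_def]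
  | succ k =>
    simp only [gapForm_succ, Fin.le_def, Fin.ext_iff]
    by_cases h : i ≤ k
    · rw [if_pos (by omega), if_pos h, if_neg (by omega), sub_self]
    · have : i ≤ k + 1 ↔ i = k + 1 := by omega
      rw [if_neg h, sub_zero]
      simp only [this]

/-- At quota 1 and weight 0 the two forms take values `±1`, so both coalitions win or both lose and
`a = 1`. Unit weight vectors then recover the members. -/
theorem constraint_inl_injective {A B : Finset (Fin n)} {a : ℝ} (ha : 0 < a)
    (h : constraint v (Sum.inl B) = a • constraint v (Sum.inl A)) : A = B := by
  have hw : ∀ w : Fin n → ℝ, coalitionWeight w A = coalitionWeight w B := by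
    have h1 := congrArg (fun f => f ((1 : ℝ), (0 : Fin n → ℝ))) h
    intro w
    have h2 := congrArg (fun f => f ((0 : ℝ), w)) h
    simp only [smul_apply, smul_eq_mul] at h1 h2
    have e : ∀ C : Finset (Fin n), coalitionWeight (0 : Fin n → ℝ) C = 0 := by
      simp [coalitionWeight]
    by_cases hA : A ∈ v.wins <;> by_cases hB : B ∈ v.wins <;>
      simp only [constraint_winning, constraint_losing, hA, hB, e, not_false_eq_true] at h1 h2
    · have : a = 1 := by linarith
      rw [this] at h2; linarith
    · linarith
    · linarith
    · have : a = 1 := by linarith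
      rw [this] at h2; linarith
  ext i
  have := hw (Pi.single i 1)
  simp only [coalitionWeight] at this
  by_cases h1 : i ∈ A <;> by_cases h2 : i ∈ B <;> simp_all

theorem constraint_not_proportional (j k : Finset (Fin n) ⊕ Fin n) (hjk : j ≠ k) (a : ℝ)
    (ha : 0 < a) : constraint v k ≠ a • constraint v j := by
  intro h
  have hq : ∀ A, constraint v (Sum.inl A) ((1 : ℝ), (0 : Fin n → ℝ)) ≠ 0 := by
    intro A
    rw [Ne, constraint_inl_eq_zero_iff]
    simp [hyperplane, coalitionWeight]
  have hg : ∀ i, constraint v (Sum.inr i) ((1 : ℝ), (0 : Fin n → ℝ)) = 0 := by simp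
  have h1 := congrArg (fun f => f ((1 : ℝ), (0 : Fin n → ℝ))) h
  simp only [smul_apply, smul_eq_mul] at h1
  rcases j with A | i <;> rcases k with B | k
  · exact hjk (congrArg _ (constraint_inl_injective ha h))
  · rw [hg, zero_eq_mul] at h1
    exact h1.elim ha.ne' (hq A)
  · rw [hg, mul_zero] at h1
    exact hq B h1
  · have h2 := congrArg (fun f => f ((0 : ℝ), fun m => if i ≤ m then (1 : ℝ) else 0)) h
    have hik : i ≠ k := fun e => hjk (congrArg _ e)
    simp [gapForm_indicator, hik] at h2
    exact ha.ne h2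

theorem isFacet_polytope_iff (hv : v.IsWeighted) {F : Set (ℝ × (Fin n → ℝ))} :
    IsFacet (polytope v) F ↔ ∃ j ∈ facetIndices v, F = face v j := by
  constructor
  · exact exists_eq_tightFace_of_isFacet strictSlice_subset_polytope polytope_subset_coneSlice
      (exists_mem_strictSlice hv) constraint_not_proportional
  · rintro ⟨j, ⟨y, hy⟩, rfl⟩
    exact isFacet_tightFace strictSlice_subset_polytope polytope_subset_coneSlice
      (exists_mem_strictSlice hv) hy

theorem face_injOn : InjOn (face v) (facetIndices v) := tightFace_injOn

theorem face_inl_subset_hyperplane (A : Finset (Fin n)) : face v (Sum.inl A) ⊆ hyperplane A :=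
  fun _ hx => constraint_inl_eq_zero_iff.1 hx.2

theorem eq_inl_of_face_subset_hyperplane {j : Finset (Fin n) ⊕ Fin n} (hj : j ∈ facetIndices v)
    {A : Finset (Fin n)} (h : face v j ⊆ hyperplane A) : j = Sum.inl A := by
  obtain ⟨y, hy⟩ := hj
  exact (hy.eq_of_eq_zero (constraint_inl_eq_zero_iff.2 (h hy.mem_tightFace))).symm

/-- In the relative interior only `j` is tight; as it is not a losing constraint, all required
strict inequalities hold. -/
theorem intrinsicInterior_face_subset_polytope {j : Finset (Fin n) ⊕ Fin n}
    (hj : j ∈ facetIndices v) (hl : ∀ B, B ∉ v.wins → Sum.inl B ≠ j) :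
    intrinsicInterior ℝ (face v j) ⊆ polytope v := by
  obtain ⟨y, hy⟩ := hj
  intro x hx
  have h := isTightAlone_of_mem_intrinsicInterior hy hx
  exact mem_polytope_of_mem_coneSlice h.mem_tightFace.1 fun B hB => h.2.2 _ (hl B hB)

theorem isTopFacet_iff (hv : v.IsWeighted) {F : Set (ℝ × (Fin n → ℝ))} :
    IsTopFacet v F ↔ ∃ A ∈ v.wins, Sum.inl A ∈ facetIndices v ∧ F = face v (Sum.inl A) := by
  constructor
  · rintro ⟨hF, ⟨A, hA, hFA⟩, -⟩
    obtain ⟨j, hj, rfl⟩ := (isFacet_polytope_iff hv).1 hF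
    obtain rfl := eq_inl_of_face_subset_hyperplane hj hFA
    exact ⟨A, hA, hj, rfl⟩
  · rintro ⟨A, hA, hj, rfl⟩
    refine ⟨(isFacet_polytope_iff hv).2 ⟨_, hj, rfl⟩, ⟨A, hA, face_inl_subset_hyperplane A⟩,
      intrinsicInterior_face_subset_polytope hj ?_⟩
    rintro B hB h
    exact hB (Sum.inl_injective h ▸ hA)

theorem isBottomFacet_iff (hv : v.IsWeighted) {F : Set (ℝ × (Fin n → ℝ))} :
    IsBottomFacet v F ↔ ∃ B, B ∉ v.wins ∧ Sum.inl B ∈ facetIndices v ∧ F = face v (Sum.inl B) := by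
  constructor
  · rintro ⟨hF, ⟨B, hB, hFB⟩, -⟩
    obtain ⟨j, hj, rfl⟩ := (isFacet_polytope_iff hv).1 hF
    obtain rfl := eq_inl_of_face_subset_hyperplane hj hFB
    exact ⟨B, hB, hj, rfl⟩
  · rintro ⟨B, hB, hj, rfl⟩
    refine ⟨(isFacet_polytope_iff hv).2 ⟨_, hj, rfl⟩, ⟨B, hB, face_inl_subset_hyperplane B⟩, ?_⟩
    refine Set.disjoint_left.2 fun x hx hP => hB ((hP.2 B).2 ?_)
    exact (face_inl_subset_hyperplane B hx).le

theorem isVerticalFacet_iff (hv : v.IsWeighted) {F : Set (ℝ × (Fin n → ℝ))} :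
    IsVerticalFacet v F ↔ ∃ i, Sum.inr i ∈ facetIndices v ∧ F = face v (Sum.inr i) := by
  constructor
  · rintro ⟨hF, ⟨m, hm⟩, -⟩
    obtain ⟨j, hj, rfl⟩ := (isFacet_polytope_iff hv).1 hF
    obtain ⟨y, hy⟩ := id hj
    have := gapForm_eq_zero_of_mem_convexHull (hm y hy.mem_tightFace)
    obtain rfl := hy.eq_of_eq_zero (k := Sum.inr m.rev) this
    exact ⟨_, hj, rfl⟩
  · rintro ⟨i, hj, rfl⟩
    refine ⟨(isFacet_polytope_iff hv).2 ⟨_, hj, rfl⟩, ⟨i.rev, fun x hx => ?_⟩,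
      intrinsicInterior_face_subset_polytope hj fun B _ => Sum.inl_ne_inr⟩
    refine mem_convexHull_of_gapForm_eq_zero (fun k => hx.1.2 (Sum.inr k))
      (mem_normalizedWeights_of_mem_coneSlice hx.1).2.2 ?_
    rw [Fin.rev_rev]
    exact hx.2

end Constraints


/-! ### Covers in `𝒲_n` and the coalitions that carry facets. -/

section Covers

variable {n : ℕ}

theorem coalitionWeight_mono {w : Fin n → ℝ} (h : ∀ i, 0 ≤ w i) {A B : Finset (Fin n)}
    (hAB : A ⊆ B) : coalitionWeight w A ≤ coalitionWeight w B :=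
  Finset.sum_le_sum_of_subset_of_nonneg hAB fun i _ _ => h i

/-- The weighted game with quota `q` and weights `w`. -/
def thresholdGame (q : ℝ) (w : Fin n → ℝ) (h0 : ∀ i, 0 ≤ w i) (hm : Monotone w) (hq : 0 < q)
    (hs : q ≤ coalitionWeight w Finset.univ) : WeightedGame n :=
  ⟨{ wins := {A | q ≤ coalitionWeight w A}
     univ_mem := hs
     empty_notMem := by
      change ¬ q ≤ coalitionWeight w ∅
      rw [coalitionWeight_empty, not_le]; exact hq
     mono := fun S R hS hSR => le_trans (b := coalitionWeight w S) hS
      (coalitionWeight_mono h0 hSR) },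
    q, w, h0, hm, hq, hs, fun _ => Iff.rfl⟩

/-- A cover is a chain of steps that cannot have length above one. Conversely, no game fits strictly
between two whose winning sets differ by a single coalition. -/
theorem WeightedGame.covBy_iff_step {u v : WeightedGame n} :
    u ⋖ v ↔ WeightedGame.Step u v := by
  have hlt : ∀ {a b : WeightedGame n}, WeightedGame.Step a b → a < b := by
    intro a b hab
    refine lt_of_le_of_ne (Relation.ReflTransGen.single hab) ?_
    rintro rfl
    obtain ⟨A, hA, h⟩ := hab
    exact hA (h ▸ mem_insert A a.1.wins)
  constructor
  · rintro ⟨h, hcov⟩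
    rcases Relation.ReflTransGen.cases_head (r := WeightedGame.Step) h.le with rfl | ⟨w, hw, hwv⟩
    · exact absurd h (lt_irrefl _)
    · rcases eq_or_lt_of_le (show w ≤ v from hwv) with rfl | hlt'
      · exact hw
      · exact absurd hlt' (hcov (hlt hw))
  · intro hst
    refine ⟨hlt hst, fun w huw hwv => ?_⟩
    obtain ⟨A, hA, h⟩ := hst
    have h1 : w.1.wins ⊆ u.1.wins := WeightedGame.wins_subset huw.le
    have h2 : v.1.wins ⊆ w.1.wins := WeightedGame.wins_subset hwv.le
    by_cases hAw : A ∈ w.1.wins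
    · refine huw.ne (Subtype.ext (SimpleGame.ext (Subset.antisymm ?_ h1)))
      rw [h]
      exact insert_subset hAw h2
    · refine hwv.ne (Subtype.ext (SimpleGame.ext (Subset.antisymm (fun C hC => ?_) h2)))
      have := h1 hC
      rw [h] at this
      rcases this with rfl | hC'
      · exact absurd hC hAw
      · exact hC'

/-- The winning coalitions whose hyperplanes carry facets. -/
def facetWins (v : SimpleGame n) : Set (Finset (Fin n)) :=
  {A | A ∈ v.wins ∧ Sum.inl A ∈ facetIndices v}

/-- The losing coalitions whose hyperplanes carry facets. -/
def facetLosses (v : SimpleGame n) : Set (Finset (Fin n)) :=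
  {A | A ∉ v.wins ∧ Sum.inl A ∈ facetIndices v}

theorem isTopGame_iff {v : SimpleGame n} : v.IsTopGame ↔ v.wins = {Finset.univ} := by
  have : generatedBy (Finset.univ : Finset (Fin n)) = {Finset.univ} := by
    ext C
    constructor
    · rintro ⟨h, -⟩
      exact (Finset.card_eq_iff_eq_univ C).1
        (le_antisymm (Finset.card_le_univ C) (by simpa using h))
    · rintro rfl
      exact ⟨le_rfl, fun i => le_rfl⟩
  rw [SimpleGame.IsTopGame, this]

theorem isBottomGame_iff {v : SimpleGame n} :
    v.IsBottomGame ↔ v.wins = {C | C.Nonempty} := by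
  have key : ∀ h : 0 < n, generatedBy {(⟨0, h⟩ : Fin n)} = {C | C.Nonempty} := by
    intro h
    ext C
    constructor
    · rintro ⟨hC, -⟩
      exact Finset.card_pos.1 (by simpa using hC)
    · intro hC
      refine ⟨by simpa using Finset.card_pos.2 hC, fun i => ?_⟩
      have : Finset.orderEmbOfFin {(⟨0, h⟩ : Fin n)} rfl i.rev = ⟨0, h⟩ :=
        Finset.mem_singleton.1 (Finset.orderEmbOfFin_mem _ rfl _)
      rw [this]
      exact Fin.mk_le_of_le_val (Nat.zero_le _)
  constructor
  · rintro ⟨h, hv⟩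
    rw [hv, key]
  · intro hv
    have h : 0 < n := by
      rcases Nat.eq_zero_or_pos n with rfl | h
      · exact absurd v.univ_mem (by rw [Finset.univ_eq_empty]; exact v.empty_notMem)
      · exact h
    exact ⟨h, by rw [hv, key]⟩

theorem exists_mem_facetWins_of_step {v u : WeightedGame n} {A : Finset (Fin n)}
    (hA : A ∉ u.1.wins) (h : v.1.wins = insert A u.1.wins) :
    A ∈ facetWins v.1 ∧ A ∈ facetLosses u.1 := by
  have hAv : A ∈ v.1.wins := h ▸ mem_insert A _
  obtain ⟨x, hx⟩ := exists_mem_strictSlice v.2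
  obtain ⟨z, hz⟩ := exists_mem_strictSlice u.2
  have hA' : ∀ y, constraint u.1 (Sum.inl A) y = -constraint v.1 (Sum.inl A) y := fun y => by
    rw [constraint_winning hAv, constraint_losing hA, neg_sub]
  have hk : ∀ k y, k ≠ Sum.inl A → constraint u.1 k y = constraint v.1 k y := by
    rintro (B | i) y hB
    · have hne : B ≠ A := fun e => hB (congrArg _ e)
      by_cases hBu : B ∈ u.1.wins
      · rw [constraint_winning hBu, constraint_winning (h ▸ mem_insert_of_mem A hBu)]
      · have hBv : B ∉ v.1.wins := by
          rw [h]; exact fun hB' => hB'.elim hne hBu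
        rw [constraint_losing hBu, constraint_losing hBv]
    · rfl
  set a := constraint v.1 (Sum.inl A) x with ha
  set b := constraint u.1 (Sum.inl A) z with hb
  have ha0 : 0 < a := hx.2 _
  have hb0 : 0 < b := hz.2 _
  have hab : (a + b) ≠ 0 := (add_pos ha0 hb0).ne'
  -- The form of `A` takes the values `a` at `x` and `-b` at `z`, so these weights make it vanish.
  -- All other constraints of the two games coincide and stay positive.
  set y := (a + b)⁻¹ • (b • x + a • z) with hy
  have hys : weightForm Finset.univ y = 1 := by
    rw [hy, map_smul, map_add, map_smul, map_smul, hx.1, hz.1]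
    simp only [smul_eq_mul]
    field_simp
    ring
  have hyA : constraint v.1 (Sum.inl A) y = 0 := by
    have : constraint v.1 (Sum.inl A) z = -b := by rw [hb, hA', neg_neg]
    rw [hy, map_smul, map_add, map_smul, map_smul, this, ← ha]
    simp only [smul_eq_mul]
    ring
  have hyk : ∀ k, k ≠ Sum.inl A → 0 < constraint v.1 k y := by
    intro k hkA
    have h1 := hx.2 k
    have h2 := hz.2 k
    rw [hk k z hkA] at h2
    rw [hy, map_smul, map_add, map_smul, map_smul]
    simp only [smul_eq_mul]
    positivity
  refine ⟨⟨hAv, y, hys, hyA, hyk⟩, hA, y, hys, by rw [hA', hyA, neg_zero], fun k hkA => ?_⟩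
  rw [hk k y hkA]
  exact hyk k hkA

theorem exists_removal_of_mem_facetWins {v : WeightedGame n} (hv : ¬ v.1.IsTopGame)
    {A : Finset (Fin n)} (hA : A ∈ facetWins v.1) :
    ∃ u : WeightedGame n, A ∉ u.1.wins ∧ v.1.wins = insert A u.1.wins := by
  obtain ⟨hAv, y, hy⟩ := hA
  have hw := mem_normalizedWeights_of_mem_coneSlice hy.mem_tightFace.1
  have hs : coalitionWeight y.2 Finset.univ = 1 := by simpa using hy.1
  have hAy := hy.2.1
  rw [constraint_winning hAv] at hAy
  -- The raised quota must not exceed the total weight. If only `N` were tight, any other winning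
  -- coalition would weigh more than `N`, forcing `v = ⟨N⟩`.
  have hAu : Finset.univ ≠ A := by
    rintro rfl
    refine hv (isTopGame_iff.2 (Subset.antisymm (fun C hC => ?_) (by simpa using v.1.univ_mem)))
    by_contra hne
    have := hy.2.2 (Sum.inl C) (fun e => hne (Sum.inl_injective e))
    rw [constraint_winning hC] at this
    have := coalitionWeight_mono hw.1 (Finset.subset_univ C)
    linarith
  obtain ⟨t, ht, hp⟩ := exists_pos_forall_pos_add_smul (constraint v.1) y (1, 0)
  have hwin : ∀ C ∈ v.1.wins, C ≠ A → y.1 + t < coalitionWeight y.2 C := by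
    intro C hC hne
    have := hp (Sum.inl C) (hy.2.2 _ fun e => hne (Sum.inl_injective e))
    rw [constraint_winning hC] at this
    simpa using this
  have hlose : ∀ C, C ∉ v.1.wins → coalitionWeight y.2 C < y.1 := by
    intro C hC
    have := hy.2.2 (Sum.inl C) (fun e => hC (Sum.inl_injective e ▸ hAv))
    rw [constraint_losing hC] at this
    linarith
  have hq : 0 < y.1 := by
    have := hlose ∅ v.1.empty_notMem
    rwa [coalitionWeight_empty] at this
  refine ⟨thresholdGame (y.1 + t) y.2 hw.1 hw.2.1 (add_pos hq ht)
    (hwin _ v.1.univ_mem hAu).le, ?_, Set.ext fun C => ⟨fun hC => ?_, ?_⟩⟩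
  · change ¬ y.1 + t ≤ coalitionWeight y.2 A
    linarith
  · by_cases hne : C = A
    · exact Or.inl hne
    · exact Or.inr (hwin C hC hne).le
  · rintro (rfl | hC)
    · exact hAv
    · by_contra hCv
      have h1 : y.1 + t ≤ coalitionWeight y.2 C := hC
      linarith [hlose C hCv]

/-- The tight point itself realizes the larger game, since there `w_B = q`. Only `B = ∅` would make
the quota 0, and then every nonempty coalition wins. -/
theorem exists_addition_of_mem_facetLosses {v : WeightedGame n} (hv : ¬ v.1.IsBottomGame)
    {B : Finset (Fin n)} (hB : B ∈ facetLosses v.1) :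
    ∃ g : WeightedGame n, B ∉ v.1.wins ∧ g.1.wins = insert B v.1.wins := by
  obtain ⟨hBv, y, hy⟩ := hB
  have hw := mem_normalizedWeights_of_mem_coneSlice hy.mem_tightFace.1
  have hBy := hy.2.1
  rw [constraint_losing hBv] at hBy
  have hwin : ∀ C ∈ v.1.wins, y.1 < coalitionWeight y.2 C := by
    intro C hC
    have := hy.2.2 (Sum.inl C) (fun e => hBv (Sum.inl_injective e ▸ hC))
    rw [constraint_winning hC] at this
    linarith
  have hlose : ∀ C, C ∉ v.1.wins → C ≠ B → coalitionWeight y.2 C < y.1 := by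
    intro C hC hne
    have := hy.2.2 (Sum.inl C) (fun e => hne (Sum.inl_injective e))
    rw [constraint_losing hC] at this
    linarith
  have hB0 : ∅ ≠ B := by
    rintro rfl
    rw [coalitionWeight_empty] at hBy
    refine hv (isBottomGame_iff.2 (Set.ext fun C => ⟨fun hC => ?_, fun hC => ?_⟩))
    · by_contra hne
      exact v.1.empty_notMem (Finset.not_nonempty_iff_eq_empty.1 hne ▸ hC)
    · by_contra hC'
      have h1 := hlose C hC' (Finset.Nonempty.ne_empty hC)
      have h2 : 0 ≤ coalitionWeight y.2 C := Finset.sum_nonneg fun i _ => hw.1 i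
      linarith
  have hq : 0 < y.1 := by
    have := hlose ∅ v.1.empty_notMem hB0
    rwa [coalitionWeight_empty] at this
  refine ⟨thresholdGame y.1 y.2 hw.1 hw.2.1 hq (hwin _ v.1.univ_mem).le, hBv,
    Set.ext fun C => ⟨fun hC => ?_, ?_⟩⟩
  · by_cases hCv : C ∈ v.1.wins
    · exact Or.inr hCv
    · refine Or.inl ?_
      by_contra hne
      exact (hlose C hCv hne).not_ge hC
  · rintro (rfl | hC)
    · exact (sub_eq_zero.1 hBy).le
    · exact (hwin C hC).le

/-- The upper covers of `v` correspond to the winning coalitions that carry facets. -/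
theorem exists_equiv_facetWins (v : WeightedGame n) (hv : ¬ v.1.IsTopGame) :
    ∃ e : {u : WeightedGame n // v ⋖ u} ≃ facetWins v.1,
      ∀ u, (e u : Finset (Fin n)) ∉ u.1.1.wins ∧ v.1.wins = insert (e u).1 u.1.1.wins := by
  have h : ∀ u : {u : WeightedGame n // v ⋖ u}, ∃ A : facetWins v.1,
      A.1 ∉ u.1.1.wins ∧ v.1.wins = insert A.1 u.1.1.wins := fun u => by
    obtain ⟨A, hA, hu⟩ := WeightedGame.covBy_iff_step.1 u.2
    exact ⟨⟨A, (exists_mem_facetWins_of_step hA hu).1⟩, hA, hu⟩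
  choose f hf using h
  have hdiff : ∀ (u : WeightedGame n) (A : Finset (Fin n)), A ∉ u.1.wins →
      v.1.wins = insert A u.1.wins → u.1.wins = v.1.wins \ {A} := fun u A hA hu => by
    rw [hu, insert_sdiff_of_mem _ (mem_singleton A), sdiff_singleton_eq_self hA]
  refine ⟨Equiv.ofBijective f ⟨fun u u' huu => ?_, fun A => ?_⟩, hf⟩
  · refine Subtype.ext (Subtype.ext (SimpleGame.ext ?_))
    rw [hdiff _ _ (hf u).1 (hf u).2, hdiff _ _ (hf u').1 (hf u').2, huu]
  · obtain ⟨u, hA, hu⟩ := exists_removal_of_mem_facetWins hv A.2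
    refine ⟨⟨u, WeightedGame.covBy_iff_step.2 ⟨A.1, hA, hu⟩⟩, Subtype.ext ?_⟩
    obtain ⟨h1, h2⟩ := hf ⟨u, WeightedGame.covBy_iff_step.2 ⟨A.1, hA, hu⟩⟩
    have : A.1 ∈ v.1.wins := A.2.1
    rw [h2] at this
    exact (this.resolve_right hA).symm

/-- The lower covers of `v` correspond to the losing coalitions that carry facets. -/
theorem exists_equiv_facetLosses (v : WeightedGame n) (hv : ¬ v.1.IsBottomGame) :
    ∃ e : {g : WeightedGame n // g ⋖ v} ≃ facetLosses v.1,
      ∀ g, (e g : Finset (Fin n)) ∉ v.1.wins ∧ g.1.1.wins = insert (e g).1 v.1.wins := by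
  have h : ∀ g : {g : WeightedGame n // g ⋖ v}, ∃ B : facetLosses v.1,
      B.1 ∉ v.1.wins ∧ g.1.1.wins = insert B.1 v.1.wins := fun g => by
    obtain ⟨B, hB, hg⟩ := WeightedGame.covBy_iff_step.1 g.2
    exact ⟨⟨B, (exists_mem_facetWins_of_step hB hg).2⟩, hB, hg⟩
  choose f hf using h
  refine ⟨Equiv.ofBijective f ⟨fun g g' hgg => ?_, fun B => ?_⟩, hf⟩
  · refine Subtype.ext (Subtype.ext (SimpleGame.ext ?_))
    rw [(hf g).2, (hf g').2, hgg]
  · obtain ⟨g, hB, hg⟩ := exists_addition_of_mem_facetLosses hv B.2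
    refine ⟨⟨g, WeightedGame.covBy_iff_step.2 ⟨B.1, hB, hg⟩⟩, Subtype.ext ?_⟩
    obtain ⟨h1, h2⟩ := hf ⟨g, WeightedGame.covBy_iff_step.2 ⟨B.1, hB, hg⟩⟩
    have : B.1 ∈ g.1.wins := hg ▸ mem_insert B.1 _
    rw [h2] at this
    exact (this.resolve_right hB).symm

theorem facetWins_of_isTopGame {v : SimpleGame n} (hw : v.IsWeighted) (hv : v.IsTopGame) :
    facetWins v = {Finset.univ} := by
  rw [isTopGame_iff] at hv
  refine Subset.antisymm (fun A hA => hv ▸ hA.1) (singleton_subset_iff.2 ⟨v.univ_mem, ?_⟩)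
  obtain ⟨x, hs, hx⟩ := exists_mem_strictSlice hw
  rw [weightForm_apply] at hs
  -- Raise the quota of a strict realization to the total weight: the other coalitions lose by even
  -- more.
  refine ⟨(1, x.2), by simpa using hs, ?_, ?_⟩
  · rw [constraint_winning v.univ_mem]
    simp [hs]
  · rintro (B | i) hB
    · have hBv : B ∉ v.wins := by
        rw [hv]
        exact fun e => hB (congrArg _ e)
      have h1 := hx (Sum.inl B)
      have h2 := hx (Sum.inl Finset.univ)
      rw [constraint_losing hBv] at h1
      rw [constraint_winning v.univ_mem] at h2
      rw [constraint_losing hBv]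
      simp only
      linarith
    · exact hx (Sum.inr i)

theorem facetLosses_of_isBottomGame {v : SimpleGame n} (hw : v.IsWeighted)
    (hv : v.IsBottomGame) : facetLosses v = {∅} := by
  rw [isBottomGame_iff] at hv
  refine Subset.antisymm (fun A hA => ?_) (singleton_subset_iff.2 ⟨v.empty_notMem, ?_⟩)
  · have := hA.1
    rw [hv] at this
    exact Finset.not_nonempty_iff_eq_empty.1 this
  obtain ⟨x, hs, hx⟩ := exists_mem_strictSlice hw
  rw [weightForm_apply] at hs
  refine ⟨(0, x.2), by simpa using hs, ?_, ?_⟩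
  · rw [constraint_losing v.empty_notMem]
    simp [coalitionWeight_empty]
  · rintro (B | i) hB
    · have hBv : B ∈ v.wins := by
        rw [hv]
        exact Finset.nonempty_iff_ne_empty.2 fun e => hB (congrArg _ e)
      have h1 := hx (Sum.inl B)
      have h2 := hx (Sum.inl ∅)
      rw [constraint_winning hBv] at h1
      rw [constraint_losing v.empty_notMem, coalitionWeight_empty] at h2
      rw [constraint_winning hBv]
      simp only
      linarith
    · exact hx (Sum.inr i)

theorem face_univ_of_isTopGame {v : SimpleGame n} (hv : v.IsTopGame) :
    face v (Sum.inl Finset.univ) = {x | x.1 = 1 ∧ x.2 ∈ normalizedWeights n} := by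
  rw [isTopGame_iff] at hv
  ext x
  constructor
  · intro hx
    have hw := mem_normalizedWeights_of_mem_coneSlice hx.1
    have h1 : x.1 = coalitionWeight x.2 Finset.univ := face_inl_subset_hyperplane _ hx
    exact ⟨h1.trans hw.2.2, hw⟩
  · rintro ⟨h1, h0, hm, hs⟩
    have hu : coalitionWeight x.2 Finset.univ = 1 := hs
    refine ⟨⟨by simpa using hu, ?_⟩, constraint_inl_eq_zero_iff.2 (h1.trans hu.symm)⟩
    rintro (B | i)
    · have := coalitionWeight_mono h0 (Finset.subset_univ B)
      by_cases hB : B ∈ v.wins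
      · have hB' : B = Finset.univ := by rwa [hv] at hB
        rw [constraint_winning hB, hB']
        linarith
      · rw [constraint_losing hB]
        linarith
    · exact gapForm_nonneg h0 hm i

theorem face_empty_of_isBottomGame {v : SimpleGame n} (hv : v.IsBottomGame) :
    face v (Sum.inl ∅) = {x | x.1 = 0 ∧ x.2 ∈ normalizedWeights n} := by
  rw [isBottomGame_iff] at hv
  ext x
  constructor
  · intro hx
    have h1 : x.1 = coalitionWeight x.2 ∅ := face_inl_subset_hyperplane _ hx
    exact ⟨h1.trans (coalitionWeight_empty _), mem_normalizedWeights_of_mem_coneSlice hx.1⟩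
  · rintro ⟨h1, h0, hm, hs⟩
    refine ⟨⟨by simpa [coalitionWeight] using hs, ?_⟩,
      constraint_inl_eq_zero_iff.2 (h1.trans (coalitionWeight_empty _).symm)⟩
    rintro (B | i)
    · by_cases hB : B ∈ v.wins
      · have h2 : 0 ≤ coalitionWeight x.2 B := Finset.sum_nonneg fun i _ => h0 i
        rw [constraint_winning hB]
        linarith
      · have hB' : B = ∅ := by
          rw [hv] at hB
          exact Finset.not_nonempty_iff_eq_empty.1 hB
        rw [constraint_losing hB, hB', coalitionWeight_empty]
        linarith
    · exact gapForm_nonneg h0 hm i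

theorem coalitionWeight_eq_sum_orderEmbOfFin (w : Fin n → ℝ) (A : Finset (Fin n)) :
    coalitionWeight w A = ∑ i : Fin A.card, w (A.orderEmbOfFin rfl i.rev) := by
  have h : ∑ i : Fin A.card, w (A.orderEmbOfFin rfl i.rev)
      = ∑ i : Fin A.card, w (A.orderEmbOfFin rfl i) :=
    Fintype.sum_equiv Fin.revPerm _ _ fun i => rfl
  rw [h, coalitionWeight]
  conv_lhs => rw [← Finset.map_orderEmbOfFin_univ A rfl]
  rw [Finset.sum_map]
  rfl

/-- Compare members rank by rank from the strongest; the surplus members of `B` add nonnegative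
weight. -/
theorem coalitionWeight_le_of_shiftLE {w : Fin n → ℝ} (h0 : ∀ i, 0 ≤ w i) (hm : Monotone w)
    {A B : Finset (Fin n)} (h : ShiftLE A B) : coalitionWeight w A ≤ coalitionWeight w B := by
  obtain ⟨hc, h⟩ := h
  rw [coalitionWeight_eq_sum_orderEmbOfFin, coalitionWeight_eq_sum_orderEmbOfFin w B]
  refine (Finset.sum_le_sum fun i _ => hm (h i)).trans ?_
  refine (Finset.sum_map Finset.univ (Fin.castLEEmb hc)
    fun i => w (B.orderEmbOfFin rfl i.rev)).symm.le.trans ?_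
  exact Finset.sum_le_sum_of_subset_of_nonneg (Finset.subset_univ _) fun i _ _ => h0 _

/-- Where only `A` is tight, a winning coalition shift-below `A` weighs at most `w_A = q`, so it is
tight too. -/
theorem isShiftMinimalWinning_of_mem_facetWins {v : SimpleGame n} {A : Finset (Fin n)}
    (hA : A ∈ facetWins v) : v.IsShiftMinimalWinning A := by
  obtain ⟨hAv, y, hy⟩ := hA
  have hw := mem_normalizedWeights_of_mem_coneSlice hy.mem_tightFace.1
  refine ⟨hAv, fun C hC hCA => ?_⟩
  by_contra hne
  have h1 := hy.2.2 (Sum.inl C) (fun e => hne (Sum.inl_injective e))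
  have h2 := hy.2.1
  rw [constraint_winning hC] at h1
  rw [constraint_winning hAv] at h2
  linarith [coalitionWeight_le_of_shiftLE hw.1 hw.2.1 hCA]

theorem isShiftMaximalLosing_of_mem_facetLosses {v : SimpleGame n} {B : Finset (Fin n)}
    (hB : B ∈ facetLosses v) : v.IsShiftMaximalLosing B := by
  obtain ⟨hBv, y, hy⟩ := hB
  have hw := mem_normalizedWeights_of_mem_coneSlice hy.mem_tightFace.1
  refine ⟨hBv, fun C hC hBC => ?_⟩
  by_contra hne
  have h1 := hy.2.2 (Sum.inl C) (fun e => hne (Sum.inl_injective e))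
  have h2 := hy.2.1
  rw [constraint_losing hC] at h1
  rw [constraint_losing hBv] at h2
  linarith [coalitionWeight_le_of_shiftLE hw.1 hw.2.1 hBC]

end Covers


/-! ### Dummies, symmetry classes and their count. -/

namespace SimpleGame

variable {n : ℕ} {v : SimpleGame n} {i j k : Fin n}

theorem EquallyDesirable.symm (h : v.EquallyDesirable i j) : v.EquallyDesirable j i :=
  fun S hj hi => (h S hi hj).symm

theorem image_swap_insert {S : Finset (Fin n)} (hi : i ∉ S) (hj : j ∉ S) :
    (insert i S).image (Equiv.swap i j) = insert j S := by
  rw [Finset.image_insert, Equiv.swap_apply_left]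
  congr 1
  refine (Finset.image_congr (g := id) fun k hk => ?_).trans Finset.image_id
  exact Equiv.swap_apply_of_ne_of_ne (fun e => hi (e ▸ hk)) (fun e => hj (e ▸ hk))

/-- Two voters are equally desirable if and only if the game is invariant under their
transposition. -/
theorem equallyDesirable_iff_image_swap :
    v.EquallyDesirable i j ↔
      ∀ A : Finset (Fin n), A.image (Equiv.swap i j) ∈ v.wins ↔ A ∈ v.wins := by
  constructor
  · intro h A
    by_cases hi : i ∈ A <;> by_cases hj : j ∈ A
    · have : A.image (Equiv.swap i j) = A := by
        refine Finset.eq_of_subset_of_card_le (fun x hx => ?_)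
          (Finset.card_image_of_injective _ (Equiv.injective _)).ge
        obtain ⟨y, hy, rfl⟩ := Finset.mem_image.1 hx
        rw [Equiv.swap_apply_def]
        split_ifs <;> assumption
      rw [this]
    · have hj' : j ∉ A.erase i := fun h => hj (Finset.mem_of_mem_erase h)
      have := h (A.erase i) (Finset.notMem_erase i A) hj'
      rwa [← image_swap_insert (Finset.notMem_erase i A) hj', Finset.insert_erase hi] at this
    · have hi' : i ∉ A.erase j := fun h => hi (Finset.mem_of_mem_erase h)
      have := h.symm (A.erase j) (Finset.notMem_erase j A) hi'
      rwa [← image_swap_insert (Finset.notMem_erase j A) hi', Finset.insert_erase hj,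
        Equiv.swap_comm] at this
    · have : A.image (Equiv.swap i j) = A := by
        refine (Finset.image_congr (g := id) fun k hk => ?_).trans Finset.image_id
        exact Equiv.swap_apply_of_ne_of_ne (fun e => hi (e ▸ hk)) (fun e => hj (e ▸ hk))
      rw [this]
  · intro h S hi hj
    rw [← h (insert i S), image_swap_insert hi hj]

theorem EquallyDesirable.refl (v : SimpleGame n) (i : Fin n) : v.EquallyDesirable i i :=
  fun _ _ _ => Iff.rfl

theorem EquallyDesirable.trans (hij : v.EquallyDesirable i j) (hjk : v.EquallyDesirable j k) :
    v.EquallyDesirable i k := by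
  rcases eq_or_ne i j with rfl | h1
  · exact hjk
  rcases eq_or_ne i k with rfl | h2
  · exact .refl v i
  rw [equallyDesirable_iff_image_swap] at *
  intro A
  -- The transposition `(i k)` is the conjugate of `(i j)` by `(j k)`, valid as `i` differs from `j`
  -- and `k`.
  have : A.image (Equiv.swap i k)
      = ((A.image (Equiv.swap j k)).image (Equiv.swap i j)).image (Equiv.swap j k) := by
    rw [Finset.image_image, Finset.image_image, ← Equiv.coe_trans, ← Equiv.coe_trans]
    have : (Equiv.swap j k).trans ((Equiv.swap i j).trans (Equiv.swap j k)) = Equiv.swap i k := by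
      ext x
      simp only [Equiv.trans_apply, Equiv.swap_apply_def]
      grind
    rw [this]
  rw [this, hjk, hij, hjk]

theorem IsDummy.erase_mem (h : v.IsDummy i) {A : Finset (Fin n)} (hA : A ∈ v.wins) :
    A.erase i ∈ v.wins := by
  induction A using Finset.strongInduction with
  | H A ih =>
    by_cases hmin : v.IsMinimalWinning A
    · rwa [Finset.erase_eq_of_notMem (h A hmin)]
    · have : ∃ C, C ⊂ A ∧ C ∈ v.wins := by
        by_contra! hcon
        exact hmin ⟨hA, hcon⟩
      obtain ⟨C, hCA, hC⟩ := this
      exact v.mono _ _ (ih C hCA hC) (Finset.erase_subset_erase i hCA.subset)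

/-- In a minimal winning coalition containing `i`, replace `i` by `j` and then drop the dummy `j`: a
proper subset would win. -/
theorem IsDummy.of_desirability (hj : v.IsDummy j)
    (h : ∀ S : Finset (Fin n), i ∉ S → j ∉ S → insert i S ∈ v.wins → insert j S ∈ v.wins) :
    v.IsDummy i := by
  intro A hA hi
  have hjA : j ∉ A := hj A hA
  have hj' : j ∉ A.erase i := fun h => hjA (Finset.mem_of_mem_erase h)
  have h1 := h (A.erase i) (Finset.notMem_erase i A) hj'
    (by rw [Finset.insert_erase hi]; exact hA.1)
  have h2 := hj.erase_mem h1
  rw [Finset.erase_insert hj'] at h2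
  exact hA.2 _ (Finset.erase_ssubset hi) h2

theorem IsDummy.equallyDesirable (hi : v.IsDummy i) (hj : v.IsDummy j) :
    v.EquallyDesirable i j := by
  have key : ∀ {a b : Fin n} {S : Finset (Fin n)}, v.IsDummy a → a ∉ S → insert a S ∈ v.wins →
      insert b S ∈ v.wins := by
    intro a b S ha haS h
    have := ha.erase_mem h
    rw [Finset.erase_insert haS] at this
    exact v.mono _ _ this (Finset.subset_insert b S)
  exact fun S hiS hjS => ⟨key hj hjS, key hi hiS⟩

theorem IsWeighted.insert_mem (hv : v.IsWeighted) (hij : i ≤ j) {S : Finset (Fin n)}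
    (hi : i ∉ S) (hj : j ∉ S) (h : insert i S ∈ v.wins) : insert j S ∈ v.wins := by
  obtain ⟨q, w, -, hm, -, -, hw⟩ := hv
  rw [hw, coalitionWeight, Finset.sum_insert hj]
  rw [hw, coalitionWeight, Finset.sum_insert hi] at h
  linarith [hm hij]

theorem IsWeighted.isDummy_of_le (hv : v.IsWeighted) (hij : i ≤ j) (hj : v.IsDummy j) :
    v.IsDummy i :=
  hj.of_desirability fun _ => hv.insert_mem hij

/-- The symmetry classes are intervals. -/
theorem IsWeighted.equallyDesirable_of_le (hv : v.IsWeighted) (hik : i ≤ k) (hkj : k ≤ j)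
    (h : v.EquallyDesirable i j) : v.EquallyDesirable k j := by
  rcases eq_or_ne i k with rfl | hne
  · exact h
  rcases eq_or_ne k j with rfl | hne'
  · exact .refl v k
  have hij : i ≠ j := fun e => hne (le_antisymm hik (e ▸ hkj))
  intro S hk hj
  refine ⟨fun hw => ?_, hv.insert_mem hkj hk hj⟩
  -- If `i` is in `S`, first upgrade `i` to `k`, then trade `j` for `i`. Otherwise trade `j` for
  -- `i`, then upgrade `i` to `k`.
  by_cases hi : i ∈ S
  · obtain ⟨T, hiT, rfl⟩ : ∃ T, i ∉ T ∧ insert i T = S :=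
      ⟨S.erase i, Finset.notMem_erase i S, Finset.insert_erase hi⟩
    simp only [Finset.mem_insert, not_or] at hk hj
    rw [Finset.insert_comm] at hw
    have h1 := hv.insert_mem hik (S := insert j T)
      (by simp [hij, hiT]) (by simp [hne', hk.2]) hw
    rw [Finset.insert_comm] at h1
    have h2 := (h (insert k T) (by simp [hne, hiT]) (by simp [hne'.symm, hj.2])).1 h1
    rwa [Finset.insert_comm] at h2
  · exact hv.insert_mem hik hi hk ((h S hi hj).1 hw)

/-- Voter `i` is equally desirable as voter `i - 1`, or a dummy if it is the first voter. -/
def IsTied (v : SimpleGame n) (i : Fin n) : Prop :=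
  ((i : ℕ) = 0 → v.IsDummy i) ∧ ∀ j : Fin n, (j : ℕ) + 1 = i → v.EquallyDesirable j i

theorem IsWeighted.isTied_of_isDummy (hv : v.IsWeighted) (hi : v.IsDummy i) : v.IsTied i :=
  ⟨fun _ => hi, fun j hj =>
    (hv.isDummy_of_le (Fin.le_def.2 (by omega)) hi).equallyDesirable hi⟩

/-- A nontrivial class is represented by its least member, which is not tied. Conversely, an untied
voter is no dummy, because all voters below a dummy are dummies. -/
theorem nontrivialClasses_eq_image (hv : v.IsWeighted) :
    v.nontrivialClasses = (fun i => {j | v.EquallyDesirable i j}) '' {i | ¬ v.IsTied i} := by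
  ext C
  constructor
  · rintro ⟨i, hi, rfl⟩
    obtain ⟨j, hij, hmin⟩ : ∃ j, v.EquallyDesirable i j ∧ ∀ k, v.EquallyDesirable i k → j ≤ k := by
      obtain ⟨j, hj⟩ := (Set.toFinite {j | v.EquallyDesirable i j}).exists_minimal
        ⟨i, .refl v i⟩
      exact ⟨j, hj.1, fun k hk => (le_total j k).elim id fun h => hj.2 hk h⟩
    refine ⟨j, fun ht => ?_, Set.ext fun k => ⟨hij.trans, hij.symm.trans⟩⟩
    rcases Nat.eq_zero_or_pos (j : ℕ) with h0 | h0
    · exact hi ((ht.1 h0).of_desirability fun S h1 h2 => (hij S h1 h2).2)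
    · have h1 := ht.2 ⟨j - 1, by omega⟩ (Nat.sub_add_cancel h0)
      have h2 := Fin.le_def.1 (hmin _ (hij.trans h1.symm))
      simp only at h2
      omega
  · rintro ⟨i, hi, rfl⟩
    exact ⟨i, fun hd => hi (hv.isTied_of_isDummy hd), rfl⟩

theorem injOn_class_of_not_isTied (hv : v.IsWeighted) :
    InjOn (fun i => {j | v.EquallyDesirable i j}) {i | ¬ v.IsTied i} := by
  have key : ∀ i j : Fin n, i < j → v.EquallyDesirable i j → v.IsTied j := by
    intro i j hij h
    have hij' := Fin.lt_def.1 hij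
    exact ⟨fun h0 => by omega, fun k hk =>
      hv.equallyDesirable_of_le (Fin.le_def.2 (by omega)) (Fin.le_def.2 (by omega)) h⟩
  intro i hi j hj hij
  have h : v.EquallyDesirable i j := by
    have e : {k | v.EquallyDesirable i k} = {k | v.EquallyDesirable j k} := hij
    have : j ∈ {k | v.EquallyDesirable j k} := EquallyDesirable.refl v j
    rwa [← e] at this
  rcases lt_trichotomy i j with hlt | heq | hlt
  · exact absurd (key i j hlt h) hj
  · exact heq
  · exact absurd (key j i hlt h.symm) hi

theorem ncard_isTied_add_ncard_nontrivialClasses (hv : v.IsWeighted) :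
    {i | v.IsTied i}.ncard + v.nontrivialClasses.ncard = n := by
  rw [nontrivialClasses_eq_image hv, (injOn_class_of_not_isTied hv).ncard_image]
  have e : {i | ¬ v.IsTied i} = {i | v.IsTied i}ᶜ := by ext; simp
  rw [e, Set.ncard_add_ncard_compl, Nat.card_eq_fintype_card, Fintype.card_fin]

end SimpleGame

/-! ### Which gaps carry facets. -/

section Vertical

variable {n : ℕ} {v : SimpleGame n}

theorem isTightAlone_inv_smul {i : Fin n} {x : ℝ × (Fin n → ℝ)}
    (h0 : constraint v (Sum.inr i) x = 0)
    (h : ∀ j, j ≠ Sum.inr i → 0 < constraint v j x) :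
    IsTightAlone (weightForm Finset.univ) (constraint v) (Sum.inr i)
      ((weightForm Finset.univ x)⁻¹ • x) := by
  have hpos : 0 < weightForm Finset.univ x := weightForm_univ_pos fun A => h _ Sum.inl_ne_inr
  refine ⟨by rw [map_smul, smul_eq_mul, inv_mul_cancel₀ hpos.ne'],
    by rw [map_smul, h0, smul_zero], fun j hj => ?_⟩
  rw [map_smul, smul_eq_mul]
  exact mul_pos (inv_pos.2 hpos) (h j hj)

/-- A point where only the gap is tight still realizes `v`, and there the voter has weight 0 or the
weight of its predecessor. -/
theorem isTied_of_mem_facetIndices {i : Fin n} (hi : Sum.inr i ∈ facetIndices v) :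
    v.IsTied i := by
  obtain ⟨y, hy⟩ := hi
  have hP : y ∈ polytope v := mem_polytope_of_mem_coneSlice hy.mem_tightFace.1
    fun B _ => hy.2.2 _ Sum.inl_ne_inr
  have hg : gapForm i y.2 = 0 := hy.2.1
  constructor
  · intro h0 A hA hiA
    have hi0 : y.2 i = 0 := by
      obtain ⟨i, hi⟩ := i
      obtain rfl : i = 0 := h0
      rwa [gapForm_zero] at hg
    refine hA.2 _ (Finset.erase_ssubset hiA) ((hP.2 _).2 ?_)
    have := (hP.2 A).1 hA.1
    rwa [coalitionWeight, ← Finset.insert_erase hiA,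
      Finset.sum_insert (Finset.notMem_erase i A), hi0, zero_add] at this
  · intro j hj S hjS hiS
    have hij : y.2 i = y.2 j := by
      obtain ⟨i, hi⟩ := i
      obtain ⟨j, hj'⟩ := j
      obtain rfl : j + 1 = i := hj
      rw [gapForm_succ] at hg
      exact sub_eq_zero.1 hg
    rw [hP.2, hP.2, coalitionWeight, coalitionWeight, Finset.sum_insert hiS,
      Finset.sum_insert hjS, hij]

/-- Set the dummy's weight to 0 in a strict realization. Winning coalitions win without it, losing
ones only get lighter, and the next gap only widens. -/
theorem mem_facetIndices_of_isDummy (hw : v.IsWeighted) {h : 0 < n}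
    (hd : v.IsDummy ⟨0, h⟩) : Sum.inr ⟨0, h⟩ ∈ facetIndices v := by
  obtain ⟨x, hs, hx⟩ := exists_mem_strictSlice hw
  have hpos : 0 < x.2 ⟨0, h⟩ := by
    have := hx (Sum.inr ⟨0, h⟩)
    rwa [constraint_inr, gapForm_zero] at this
  set w' := Function.update x.2 ⟨0, h⟩ 0 with hw'
  have hle : ∀ k, w' k ≤ x.2 k := by
    intro k
    by_cases hk : k = ⟨0, h⟩
    · rw [hk, hw', Function.update_self]; exact hpos.le
    · rw [hw', Function.update_of_ne hk]
  have hne : ∀ k (hk : k + 1 < n), w' ⟨k + 1, hk⟩ = x.2 ⟨k + 1, hk⟩ := fun k hk => by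
    rw [hw', Function.update_of_ne (by simp)]
  refine ⟨_, isTightAlone_inv_smul (x := (x.1, w')) ?_ ?_⟩
  · rw [constraint_inr, gapForm_zero]
    simp [hw']
  · rintro (A | ⟨k, hk⟩) hj
    · by_cases hA : A ∈ v.wins
      · have h1 := hx (Sum.inl (A.erase ⟨0, h⟩))
        rw [constraint_winning (hd.erase_mem hA)] at h1
        rw [constraint_winning hA]
        have h2 : coalitionWeight w' (A.erase ⟨0, h⟩)
            = coalitionWeight x.2 (A.erase ⟨0, h⟩) :=
          Finset.sum_congr rfl fun k hk => by
            rw [hw', Function.update_of_ne (Finset.ne_of_mem_erase hk)]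
        have h3 : coalitionWeight w' (A.erase ⟨0, h⟩) ≤ coalitionWeight w' A := by
          refine Finset.sum_le_sum_of_subset_of_nonneg (Finset.erase_subset _ _)
            fun k hkA hk => ?_
          have : k = ⟨0, h⟩ := by
            by_contra hne
            exact hk (Finset.mem_erase.2 ⟨hne, hkA⟩)
          rw [this, hw', Function.update_self]
        simp only
        linarith
      · have h1 := hx (Sum.inl A)
        rw [constraint_losing hA] at h1 ⊢
        have h2 : coalitionWeight w' A ≤ coalitionWeight x.2 A :=
          Finset.sum_le_sum fun k _ => hle k
        simp only
        linarith
    · cases k with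
      | zero => exact absurd rfl hj
      | succ k =>
        have h1 := hx (Sum.inr ⟨k + 1, hk⟩)
        rw [constraint_inr, gapForm_succ] at h1 ⊢
        simp only
        rw [hne]
        linarith [hle ⟨k, Nat.lt_of_succ_lt hk⟩]

theorem mem_facetIndices_of_equallyDesirable (hw : v.IsWeighted) {i : ℕ} (h : i + 1 < n)
    (hd : v.EquallyDesirable ⟨i, Nat.lt_of_succ_lt h⟩ ⟨i + 1, h⟩) :
    Sum.inr ⟨i + 1, h⟩ ∈ facetIndices v := by
  obtain ⟨x, hs, hx⟩ := exists_mem_strictSlice hw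
  have hgap : ∀ k (hk : k + 1 < n), x.2 ⟨k, Nat.lt_of_succ_lt hk⟩ < x.2 ⟨k + 1, hk⟩ := by
    intro k hk
    have := hx (Sum.inr ⟨k + 1, hk⟩)
    rw [constraint_inr, gapForm_succ] at this
    linarith
  set a : Fin n := ⟨i, Nat.lt_of_succ_lt h⟩ with ha
  set b : Fin n := ⟨i + 1, h⟩ with hb
  have hab : x.2 a < x.2 b := hgap i h
  -- Averaging over the transposition preserves the strict coalition inequalities, as the game is
  -- invariant. The swapped weights are not monotone, so the gaps are checked by hand.
  set w' : Fin n → ℝ := fun k => (x.2 k + x.2 (Equiv.swap a b k)) / 2 with hw'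
  have hwa : w' a = (x.2 a + x.2 b) / 2 := by simp [hw']
  have hwb : w' b = (x.2 a + x.2 b) / 2 := by simp [hw', add_comm]
  have hwk : ∀ k, k ≠ a → k ≠ b → w' k = x.2 k := fun k h1 h2 => by
    simp [hw', Equiv.swap_apply_of_ne_of_ne h1 h2]
  have hsum : ∀ A : Finset (Fin n), coalitionWeight w' A
      = (coalitionWeight x.2 A + coalitionWeight x.2 (A.image (Equiv.swap a b))) / 2 := by
    intro A
    rw [coalitionWeight, coalitionWeight, coalitionWeight,
      Finset.sum_image (Equiv.injective _).injOn, ← Finset.sum_add_distrib, Finset.sum_div]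
  have hinv := SimpleGame.equallyDesirable_iff_image_swap.1 hd
  refine ⟨_, isTightAlone_inv_smul (x := (x.1, w')) ?_ ?_⟩
  · rw [constraint_inr, gapForm_succ]
    simp only [← ha, ← hb, hwa, hwb, sub_self]
  · rintro (A | ⟨k, hk⟩) hj
    · have h1 := hx (Sum.inl A)
      have h2 := hx (Sum.inl (A.image (Equiv.swap a b)))
      by_cases hA : A ∈ v.wins
      · rw [constraint_winning hA] at h1 ⊢
        rw [constraint_winning ((hinv A).2 hA)] at h2
        simp only [hsum]
        linarith
      · rw [constraint_losing hA] at h1 ⊢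
        rw [constraint_losing (mt (hinv A).1 hA)] at h2
        simp only [hsum]
        linarith
    · rw [constraint_inr]
      cases k with
      | zero =>
        have h1 := hx (Sum.inr ⟨0, hk⟩)
        rw [constraint_inr, gapForm_zero] at h1
        rw [gapForm_zero]
        by_cases h0 : (⟨0, hk⟩ : Fin n) = a
        · rw [h0] at h1 ⊢
          simp only [hwa]
          linarith
        · simp only
          rwa [hwk _ h0 (by simp [hb])]
      | succ k =>
        have hki : k ≠ i := by
          rintro rfl
          exact hj rfl
        have h1 := hgap k hk
        rw [gapForm_succ, sub_pos]
        simp only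
        have hkb : (⟨k + 1, hk⟩ : Fin n) ≠ b := by simpa [hb] using hki
        have hka : (⟨k, Nat.lt_of_succ_lt hk⟩ : Fin n) ≠ a := by simpa [ha] using hki
        by_cases e1 : (⟨k + 1, hk⟩ : Fin n) = a
        · rw [e1] at h1 ⊢
          have hkb' : (⟨k, Nat.lt_of_succ_lt hk⟩ : Fin n) ≠ b := by
            have := congrArg Fin.val e1
            simp only [ha] at this
            simp only [hb, Ne, Fin.mk.injEq]
            omega
          rw [hwa, hwk _ hka hkb']
          linarith
        · rw [hwk _ e1 hkb]
          by_cases e2 : (⟨k, Nat.lt_of_succ_lt hk⟩ : Fin n) = b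
          · rw [e2] at h1 ⊢
            rw [hwb]
            linarith
          · rwa [hwk _ hka e2]

theorem inr_mem_facetIndices_iff (hw : v.IsWeighted) {i : Fin n} :
    Sum.inr i ∈ facetIndices v ↔ v.IsTied i := by
  refine ⟨isTied_of_mem_facetIndices, fun h => ?_⟩
  obtain ⟨i, hi⟩ := i
  cases i with
  | zero => exact mem_facetIndices_of_isDummy hw (h.1 rfl)
  | succ i => exact mem_facetIndices_of_equallyDesirable hw hi (h.2 ⟨i, _⟩ rfl)

end Vertical


/-! ### Counting facets. -/

section Counting

variable {n : ℕ}

instance : Finite (SimpleGame n) :=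
  Finite.of_injective SimpleGame.wins fun _ _ h => SimpleGame.ext h

instance : Finite (WeightedGame n) := Subtype.finite

theorem setOf_isTopFacet {v : SimpleGame n} (hv : v.IsWeighted) :
    {F | IsTopFacet v F} = (fun A => face v (Sum.inl A)) '' facetWins v := by
  ext F
  rw [mem_ofPred_eq, isTopFacet_iff hv]
  exact ⟨fun ⟨A, h1, h2, h3⟩ => ⟨A, ⟨h1, h2⟩, h3.symm⟩, fun ⟨A, ⟨h1, h2⟩, h3⟩ =>
    ⟨A, h1, h2, h3.symm⟩⟩

theorem setOf_isBottomFacet {v : SimpleGame n} (hv : v.IsWeighted) :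
    {F | IsBottomFacet v F} = (fun A => face v (Sum.inl A)) '' facetLosses v := by
  ext F
  rw [mem_ofPred_eq, isBottomFacet_iff hv]
  exact ⟨fun ⟨A, h1, h2, h3⟩ => ⟨A, ⟨h1, h2⟩, h3.symm⟩, fun ⟨A, ⟨h1, h2⟩, h3⟩ =>
    ⟨A, h1, h2, h3.symm⟩⟩

theorem setOf_isVerticalFacet {v : SimpleGame n} (hv : v.IsWeighted) :
    {F | IsVerticalFacet v F} = (fun i => face v (Sum.inr i)) '' {i | v.IsTied i} := by
  ext F
  rw [mem_ofPred_eq, isVerticalFacet_iff hv]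
  simp only [inr_mem_facetIndices_iff hv]
  exact ⟨fun ⟨i, h1, h2⟩ => ⟨i, h1, h2.symm⟩, fun ⟨i, h1, h2⟩ => ⟨i, h1, h2.symm⟩⟩

theorem face_inl_injOn {v : SimpleGame n} {S : Set (Finset (Fin n))}
    (h : ∀ A ∈ S, Sum.inl A ∈ facetIndices v) :
    InjOn (fun A => face v (Sum.inl A)) S := fun A hA B hB hAB =>
  Sum.inl_injective (face_injOn (h A hA) (h B hB) hAB)

theorem ncard_isVerticalFacet {v : SimpleGame n} (hv : v.IsWeighted) :
    {F | IsVerticalFacet v F}.ncard + v.nontrivialClasses.ncard = n := by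
  rw [setOf_isVerticalFacet hv, InjOn.ncard_image, v.ncard_isTied_add_ncard_nontrivialClasses hv]
  exact fun i hi j hj hij => Sum.inr_injective
    (face_injOn ((inr_mem_facetIndices_iff hv).2 hi) ((inr_mem_facetIndices_iff hv).2 hj) hij)

theorem facetIndices_eq_union {v : SimpleGame n} (hv : v.IsWeighted) :
    facetIndices v = (Sum.inl '' facetWins v ∪ Sum.inl '' facetLosses v) ∪
      Sum.inr '' {i | v.IsTied i} := by
  ext (A | i)
  · by_cases hA : A ∈ v.wins <;> simp [facetWins, facetLosses, hA]
  · simp [inr_mem_facetIndices_iff hv]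

theorem ncard_isFacet {v : SimpleGame n} (hv : v.IsWeighted) :
    {F | IsFacet (polytope v) F}.ncard =
      (facetWins v).ncard + (facetLosses v).ncard + {i | v.IsTied i}.ncard := by
  have h : {F | IsFacet (polytope v) F} = face v '' facetIndices v := by
    ext F
    rw [mem_ofPred_eq, isFacet_polytope_iff hv]
    exact ⟨fun ⟨j, h1, h2⟩ => ⟨j, h1, h2.symm⟩, fun ⟨j, h1, h2⟩ => ⟨j, h1, h2.symm⟩⟩
  have hd : Disjoint (Sum.inl '' facetWins v : Set (Finset (Fin n) ⊕ Fin n))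
      (Sum.inl '' facetLosses v) :=
    (disjoint_image_iff Sum.inl_injective).2
      (Set.disjoint_left.2 fun _ h1 h2 => h2.1 h1.1)
  have hd' : Disjoint (Sum.inl '' facetWins v ∪ Sum.inl '' facetLosses v)
      (Sum.inr '' {i | v.IsTied i}) := by
    rw [← image_union]
    exact disjoint_image_inl_image_inr
  rw [h, face_injOn.ncard_image, facetIndices_eq_union hv, ncard_union_eq hd', ncard_union_eq hd,
    ncard_image_of_injective _ Sum.inl_injective, ncard_image_of_injective _ Sum.inl_injective,
    ncard_image_of_injective _ Sum.inr_injective]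

-- The extra 1 is the facet of `N` in `⟨N⟩`, which comes from no upper cover: removing `N` would
-- leave no winning coalition.
open Classical in
theorem ncard_facetWins (v : WeightedGame n) :
    (facetWins v.1).ncard = {u | v ⋖ u}.ncard + if v.1.IsTopGame then 1 else 0 := by
  by_cases hv : v.1.IsTopGame
  · have h : {u | v ⋖ u} = ∅ := by
      refine eq_empty_of_forall_notMem fun u hu => ?_
      obtain ⟨A, hA, h⟩ := WeightedGame.covBy_iff_step.1 hu
      have h1 : A ∈ v.1.wins := h ▸ mem_insert A _
      rw [isTopGame_iff.1 hv] at h1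
      exact hA ((mem_singleton_iff.1 h1) ▸ u.1.univ_mem)
    rw [facetWins_of_isTopGame v.2 hv, ncard_singleton, h, ncard_empty, if_pos hv]
  · obtain ⟨e, -⟩ := exists_equiv_facetWins v hv
    rw [if_neg hv, add_zero]
    exact (Nat.card_congr e).symm

open Classical in
theorem ncard_facetLosses (v : WeightedGame n) :
    (facetLosses v.1).ncard = {g | g ⋖ v}.ncard + if v.1.IsBottomGame then 1 else 0 := by
  by_cases hv : v.1.IsBottomGame
  · have h : {g | g ⋖ v} = ∅ := by
      refine eq_empty_of_forall_notMem fun g hg => ?_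
      obtain ⟨B, hB, h⟩ := WeightedGame.covBy_iff_step.1 hg
      have h1 : B ∈ g.1.wins := h ▸ mem_insert B _
      rw [isBottomGame_iff.1 hv] at hB
      exact g.1.empty_notMem ((Finset.not_nonempty_iff_eq_empty.1 hB) ▸ h1)
    rw [facetLosses_of_isBottomGame v.2 hv, ncard_singleton, h, ncard_empty, if_pos hv]
  · obtain ⟨e, -⟩ := exists_equiv_facetLosses v hv
    rw [if_neg hv, add_zero]
    exact (Nat.card_congr e).symm

theorem hasseDegree_eq (v : WeightedGame n) :
    hasseDegree v = {u | v ⋖ u}.ncard + {g | g ⋖ v}.ncard := by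
  have h : (SimpleGraph.hasse (WeightedGame n)).neighborSet v = {u | v ⋖ u} ∪ {g | g ⋖ v} := by
    ext u
    simp [SimpleGraph.hasse_adj]
  rw [hasseDegree, h, ncard_union_eq]
  exact Set.disjoint_left.2 fun u h1 h2 => lt_asymm (CovBy.lt h1) (CovBy.lt h2)

end Counting

end WeightedVoting

open WeightedVoting
theorem theorem4p9 (n : ℕ) (v : WeightedGame n) :
    -- every facet is a top, bottom or vertical facet, and the total number of facets
    (∀ F, IsFacet (polytope v.1) F →
      IsTopFacet v.1 F ∨ IsBottomFacet v.1 F ∨ IsVerticalFacet v.1 F) ∧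
    {F | IsFacet (polytope v.1) F}.Finite ∧
    (({F | IsFacet (polytope v.1) F}.ncard : ℤ) =
      (n : ℤ) - (v.1.nontrivialClasses.ncard : ℤ) + (hasseDegree v : ℤ)
        + (extremalCount v.1 : ℤ)) ∧
    -- top facets
    (¬ v.1.IsTopGame →
      ∃ Φ : {u : WeightedGame n // v ⋖ u} ≃ {F // IsTopFacet v.1 F},
        ∀ u : {u : WeightedGame n // v ⋖ u}, ∃ A : Finset (Fin n),
          u.1.1.wins ⊆ v.1.wins ∧ v.1.wins \ u.1.1.wins = {A} ∧
          (Φ u).1 ⊆ hyperplane A ∧ v.1.IsShiftMinimalWinning A) ∧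
    (v.1.IsTopGame →
      {F | IsTopFacet v.1 F} = {{x | x.1 = 1 ∧ x.2 ∈ normalizedWeights n}}) ∧
    -- bottom facets
    (¬ v.1.IsBottomGame →
      ∃ Ψ : {g : WeightedGame n // g ⋖ v} ≃ {F // IsBottomFacet v.1 F},
        ∀ g : {g : WeightedGame n // g ⋖ v}, ∃ B : Finset (Fin n),
          v.1.wins ⊆ g.1.1.wins ∧ g.1.1.wins \ v.1.wins = {B} ∧
          (Ψ g).1 ⊆ hyperplane B ∧ v.1.IsShiftMaximalLosing B) ∧
    (v.1.IsBottomGame →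
      {F | IsBottomFacet v.1 F} = {{x | x.1 = 0 ∧ x.2 ∈ normalizedWeights n}}) ∧
    -- vertical facets
    {F | IsVerticalFacet v.1 F}.Finite ∧
    (({F | IsVerticalFacet v.1 F}.ncard : ℤ) =
      (n : ℤ) - (v.1.nontrivialClasses.ncard : ℤ)) ∧
    (∀ F, IsVerticalFacet v.1 F →
      (∃ (i : ℕ) (h : i + 1 < n), ∀ x ∈ F,
        x.2 ∈ normalizedWeights n ∧ x.2 ⟨i + 1, h⟩ = x.2 ⟨i, Nat.lt_of_succ_lt h⟩) ∨
      (∃ h : 0 < n, ∀ x ∈ F, x.2 ∈ normalizedWeights n ∧ x.2 ⟨0, h⟩ = 0)) := by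
  have hv := v.2
  have hdiff : ∀ {S T : Set (Finset (Fin n))} {A : Finset (Fin n)}, A ∉ S → T = insert A S →
      S ⊆ T ∧ T \ S = {A} := by
    rintro S T A hA rfl
    refine ⟨subset_insert A S, Set.ext fun C => ⟨fun hC => hC.1.resolve_right hC.2, ?_⟩⟩
    rintro rfl
    exact ⟨mem_insert _ S, hA⟩
  refine ⟨fun F hF => ?_, ?_, ?_, fun ht => ?_, fun ht => ?_, fun hb => ?_, fun hb => ?_, ?_, ?_,
    fun F hF => ?_⟩
  · obtain ⟨j, hj, rfl⟩ := (isFacet_polytope_iff hv).1 hF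
    rcases j with A | i
    · by_cases hA : A ∈ v.1.wins
      · exact Or.inl ((isTopFacet_iff hv).2 ⟨A, hA, hj, rfl⟩)
      · exact Or.inr (Or.inl ((isBottomFacet_iff hv).2 ⟨A, hA, hj, rfl⟩))
    · exact Or.inr (Or.inr ((isVerticalFacet_iff hv).2 ⟨i, hj, rfl⟩))
  · refine ((facetIndices v.1).toFinite.image (face v.1)).subset fun F hF => ?_
    obtain ⟨j, hj, rfl⟩ := (isFacet_polytope_iff hv).1 hF
    exact mem_image_of_mem _ hj
  · have h1 := v.1.ncard_isTied_add_ncard_nontrivialClasses hv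
    have h2 := ncard_facetWins v
    have h3 := ncard_facetLosses v
    rw [ncard_isFacet hv, hasseDegree_eq, extremalCount]
    omega
  · obtain ⟨e, he⟩ := exists_equiv_facetWins v ht
    have hinj := face_inl_injOn (v := v.1) (S := facetWins v.1) fun A hA => hA.2
    refine ⟨(e.trans (Equiv.Set.imageOfInjOn _ _ hinj)).trans
      (Equiv.setCongr (setOf_isTopFacet hv).symm), fun u => ⟨e u, ?_⟩⟩
    obtain ⟨h1, h2⟩ := hdiff (he u).1 (he u).2
    exact ⟨h1, h2, face_inl_subset_hyperplane _, isShiftMinimalWinning_of_mem_facetWins (e u).2⟩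
  · rw [setOf_isTopFacet hv, facetWins_of_isTopGame hv ht, image_singleton,
      face_univ_of_isTopGame ht]
  · obtain ⟨e, he⟩ := exists_equiv_facetLosses v hb
    have hinj := face_inl_injOn (v := v.1) (S := facetLosses v.1) fun A hA => hA.2
    refine ⟨(e.trans (Equiv.Set.imageOfInjOn _ _ hinj)).trans
      (Equiv.setCongr (setOf_isBottomFacet hv).symm), fun g => ⟨e g, ?_⟩⟩
    obtain ⟨h1, h2⟩ := hdiff (he g).1 (he g).2
    exact ⟨h1, h2, face_inl_subset_hyperplane _,
      isShiftMaximalLosing_of_mem_facetLosses (e g).2⟩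
  · rw [setOf_isBottomFacet hv, facetLosses_of_isBottomGame hv hb, image_singleton,
      face_empty_of_isBottomGame hb]
  · rw [setOf_isVerticalFacet hv]
    exact toFinite _
  · have := ncard_isVerticalFacet hv
    omega
  · obtain ⟨⟨i, hi⟩, -, rfl⟩ := (isVerticalFacet_iff hv).1 hF
    cases i with
    | zero =>
      refine Or.inr ⟨hi, fun x hx => ⟨mem_normalizedWeights_of_mem_coneSlice hx.1, ?_⟩⟩
      exact (gapForm_zero hi x.2).symm.trans hx.2
    | succ i =>
      refine Or.inl ⟨i, hi, fun x hx => ⟨mem_normalizedWeights_of_mem_coneSlice hx.1, ?_⟩⟩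
      exact sub_eq_zero.1 ((gapForm_succ hi x.2).symm.trans hx.2)
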